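/- **Setting.** Let $(M^{2n},g_0,J_\pm)$ be a generalized Kähler manifold, i.e. $J_\pm$ are integrable complex structures compatible with the Riemannian metric $g_0$ and, with $\omega_\pm=g_0(J_\pm\cdot,\cdot)$, $d^c_+\omega_+=-d^c_-\omega_-$ and $dd^c_+\omega_+=-dd^c_-\omega_-=0$. Assume $[J_+,J_-]=0$, and let $TM=T_+M\oplus T_-M$, $T_\pm M=\ker(J_+\pm J_-)$. We use local coordinates, holomorphic for $J_+$, that are adapted to this splitting; indices $\alpha_\pm,\mu_\pm,\dots$ refer to coordinates along $T_\pm$. A metric $k$ compatible with $J_+$ and $J_-$ has coefficients $k_{i\bar j}$, Kähler form $\sqrt{-1}\,k_{i\bar j}\,dz^i\wedge d\bar z^j$ and induced Hermitian metrics $k_\pm$ on $T_\pm$. For any coefficients $k_{i\bar j}$ put $T^k_{ij\bar l}=\partial_i k_{j\bar l}-\partial_j k_{i\bar l}$ (the torsion of the Chern connection if $k$ is a metric), and let $\nabla^k$ be the Chern connection of a metric $k$, $\Gamma_{ij}^m=k^{\bar l m}\partial_i k_{j\bar l}$. Let $h$ be a fixed Riemannian metric compatible with $J_+$ and $J_-$,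 let $\rho(h_\pm)=-\sqrt{-1}\,\partial\bar\partial\log\det h_\pm$, let the superscripts $\pm$ denote the components in $\Lambda^{1,0}_\pm\wedge\Lambda^{0,1}_\pm$, and set $$P(h)=\rho^+(h_+)-\rho^+(h_-)-\rho^-(h_+)+\rho^-(h_-),\qquad \tilde\omega_t=\omega_0-tP(h),$$ where $\omega_0=g_0(J_+\cdot,\cdot)$. Write $\tilde g=\tilde g_t$ for the coefficients of $\tilde\omega_t$ and $\tilde T$ for $T^{\tilde g}$. On $[0,\tau)\times M$ let $f$ be a smooth solution of $$\frac{\partial f}{\partial t}=\log\frac{\det g_+\det h_-}{\det h_+\det g_-},\qquad f(0)=0,$$ where $g=g_t$ are the metrics compatible with $J_\pm$ whose Kähler forms with respect to $J_+$ are $\omega_t=\tilde\omega_t+(\delta_+\delta_+^c-\delta_-\delta_-^c)f_t$, with $\delta_\pm\delta^c_\pm f=f_{,\alpha_\pm\bar\beta_\pm}\sqrt{-1}\,dz^{\alpha_\pm}\wedge d\bar z^{\beta_\pm}$. Write $T=T^g$ and let $\Delta=g^{\bar j i}\nabla^g_i\nabla^g_{\bar j}$ be the Chern Laplacian of $g_t$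 on tensors. Components with indices $\mu_+\mu_-$ of $\partial_-\partial_+f$ and of $\Psi$ are the coefficients of $dz^{\mu_-}\wedge dz^{\mu_+}$, so $(\partial_-\partial_+f)_{\mu_+\mu_-}=f_{,\mu_+\mu_-}$. **Statement.** For all $t\in[0,\tau)$, $$\frac{\partial}{\partial t}\,\partial_-\partial_+f=\Delta\,\partial_-\partial_+f+\Psi,$$ where $$\begin{aligned} \Psi_{\mu_+\mu_-}={}&(\operatorname{tr}_{h_-}\nabla^hT^h)_{\mu_+\mu_-}-h^{\bar\beta_-\alpha_-}h^{\bar\sigma_+\gamma_+}T^h_{\mu_+\mu_-\bar\sigma_+}T^h_{\gamma_+\alpha_-\bar\beta_-}\\ &-(\operatorname{tr}_{h_+}\nabla^hT^h)_{\mu_+\mu_-}-h^{\bar\beta_+\alpha_+}h^{\bar\sigma_-\gamma_-}T^h_{\mu_+\mu_-\bar\sigma_-}T^h_{\gamma_-\alpha_+\bar\beta_+}\\ &-(\operatorname{tr}_{g_-}\nabla^g\tilde T)_{\mu_+\mu_-}+g^{\bar\beta_-\alpha_-}g^{\bar\sigma_+\gamma_+}T_{\mu_+\mu_-\bar\sigma_+}\tilde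 T_{\gamma_+\alpha_-\bar\beta_-}\\ &+(\operatorname{tr}_{g_+}\nabla^g\tilde T)_{\mu_+\mu_-}+g^{\bar\beta_+\alpha_+}g^{\bar\sigma_-\gamma_-}T_{\mu_+\mu_-\bar\sigma_-}\tilde T_{\gamma_-\alpha_+\bar\beta_+}\\ &+g^{\bar\beta_-\alpha_-}g^{\bar\gamma_+\delta_+}T_{\alpha_-\mu_+\bar\gamma_+}\tilde T_{\delta_+\mu_-\bar\beta_-}-g^{\bar\beta_+\alpha_+}g^{\bar\gamma_-\delta_-}T_{\alpha_+\mu_-\bar\gamma_-}\tilde T_{\delta_-\mu_+\bar\beta_+}, \end{aligned}$$ with, for a metric $k$ and a torsion $S$, $$(\operatorname{tr}_{k_-}\nabla^kS)_{\mu_+\mu_-}=k^{\bar\beta_-\alpha_-}\nabla^k_{\mu_-}S_{\mu_+\alpha_-\bar\beta_-},\qquad(\operatorname{tr}_{k_+}\nabla^kS)_{\mu_+\mu_-}=k^{\bar\beta_+\alpha_+}\nabla^k_{\mu_+}S_{\mu_-\alpha_+\bar\beta_+}.$$ Moreover, for a given value of the metric $g$ at a point and a given background $(h,\tilde g)$,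 $\Psi$ depends at most linearly (i.e. as an affine function) on the coefficients $\Gamma$ of the Chern connection of $g$ there, the torsion being $T_{ij\bar l}=(\Gamma_{ij}^k-\Gamma_{ji}^k)g_{k\bar l}$. If the background is Kähler, i.e. $T^h=0$ and $\tilde T=0$, then $\Psi=0$. -/

import Mathlib

open Set
open scoped Manifold ContDiff Topology

noncomputable section

namespace SplitGK

/-- The model space `ℂ^p × ℂ^q`, used as a real vector space of dimension `2 (p + q)`. Indices
`Sum.inl α` are the coordinates of `T₊`, indices `Sum.inr α` are those of `T₋`. -/
abbrev Model (p q : ℕ) : Type := Fin p ⊕ Fin q → ℂ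

/-- A Hermitian matrix of metric coefficients `g_{i j̄}`; row index `i`, column index `j̄`. -/
abbrev Coeff (p q : ℕ) : Type := Matrix (Fin p ⊕ Fin q) (Fin p ⊕ Fin q) ℂ

/-- Coefficients `Γ_{ij}^k` of a connection, as `A i j k`. -/
abbrev ConnCoeff (p q : ℕ) : Type :=
  Fin p ⊕ Fin q → Fin p ⊕ Fin q → Fin p ⊕ Fin q → ℂ

/-! ### Calculus in local complex coordinates -/

section Local

variable {p q : ℕ}

/-- `∂u/∂z_i = (∂u/∂x_i - √-1 ∂u/∂y_i) / 2`. -/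
def wd (i : Fin p ⊕ Fin q) (u : Model p q → ℂ) (z : Model p q) : ℂ :=
  (1 / 2) * (fderiv ℝ u z (Pi.single i 1) - Complex.I * fderiv ℝ u z (Pi.single i Complex.I))

/-- `∂u/∂z̄_i = (∂u/∂x_i + √-1 ∂u/∂y_i) / 2`. -/
def wdbar (i : Fin p ⊕ Fin q) (u : Model p q → ℂ) (z : Model p q) : ℂ :=
  (1 / 2) * (fderiv ℝ u z (Pi.single i 1) + Complex.I * fderiv ℝ u z (Pi.single i Complex.I))

/-- Christoffel symbols of the Chern connection of the metric `S`:
`Γ_{ij}^k = S^{l̄ k} ∂_i S_{j l̄}`. -/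
def chernConn (S : Model p q → Coeff p q) (z : Model p q) : ConnCoeff p q := fun i j k =>
  ∑ l, wd i (fun w => S w j l) z * (S z)⁻¹ l k

/-- The torsion of a connection with coefficients `A`, last index lowered with `G`:
`T_{i j l̄} = (A_{ij}^k - A_{ji}^k) G_{k l̄}`. -/
def connTorsion (G : Coeff p q) (A : ConnCoeff p q) (i j l : Fin p ⊕ Fin q) : ℂ :=
  ∑ k, (A i j k - A j i k) * G k l

/-- The Chern torsion of `S`, last index lowered with `S`:
`T_{i j l̄} = ∂_i S_{j l̄} - ∂_j S_{i l̄}`. -/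
def torsion (S : Model p q → Coeff p q) (z : Model p q) (i j l : Fin p ⊕ Fin q) : ℂ :=
  wd i (fun w => S w j l) z - wd j (fun w => S w i l) z

/-- The two descriptions of the Chern torsion agree. -/
theorem connTorsion_chernConn (S : Model p q → Coeff p q) (z : Model p q)
    (hS : IsUnit (S z).det) (i j l : Fin p ⊕ Fin q) :
    connTorsion (S z) (chernConn S z) i j l = torsion S z i j l := by
  have key : ∀ a b : Fin p ⊕ Fin q,
      ∑ k, (∑ m, wd a (fun w => S w b m) z * (S z)⁻¹ m k) * S z k l
        = wd a (fun w => S w b l) z := by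
    intro a b
    have h := congrFun (Matrix.vecMul_vecMul (fun m => wd a (fun w => S w b m) z) (S z)⁻¹ (S z)) l
    rw [Matrix.nonsing_inv_mul _ hS, Matrix.vecMul_one] at h
    simpa [Matrix.vecMul, dotProduct] using h
  simp only [connTorsion, chernConn, torsion, sub_mul, Finset.sum_sub_distrib, key]

/-- The covariant derivative `∇_i T_{j k l̄}` of the torsion of `S` with respect to the Chern-type
connection with coefficients `A` (whose `∇_i` acts trivially on the barred index). -/
def covTorsion (A : ConnCoeff p q) (S : Model p q → Coeff p q) (z : Model p q)
    (i j k l : Fin p ⊕ Fin q) : ℂ :=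
  wd i (fun w => torsion S w j k l) z
    - ∑ m, A i j m * torsion S z m k l - ∑ m, A i k m * torsion S z j m l

/-- The array of components of the form `∑ c_{μ ν} dz^{ν₋} ∧ dz^{μ₊}`, antisymmetric in its two
indices, normalized so that its `(μ₊, ν₋)` entry is `c_{μ ν}`. -/
def mixedForm (c : Fin p → Fin q → ℂ) : Fin p ⊕ Fin q → Fin p ⊕ Fin q → ℂ
  | Sum.inl μ, Sum.inr ν => c μ ν
  | Sum.inr ν, Sum.inl μ => -c μ ν
  | _, _ => 0

/-- The torsion potential `∂₋∂₊ u = ∑ u_{,μ₊ ν₋} dz^{ν₋} ∧ dz^{μ₊}`. -/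
def torsionPotential (u : Model p q → ℂ) (z : Model p q) :
    Fin p ⊕ Fin q → Fin p ⊕ Fin q → ℂ :=
  mixedForm fun μ ν => wd (Sum.inr ν) (wd (Sum.inl μ) u) z

/-- The Chern Laplacian `Δβ = S^{b̄ a} ∇_a ∇_{b̄} β` of the metric `S` on covariant `(2,0)`-tensors. -/
def chernLaplacian (S : Model p q → Coeff p q)
    (β : Model p q → Fin p ⊕ Fin q → Fin p ⊕ Fin q → ℂ) (z : Model p q)
    (i j : Fin p ⊕ Fin q) : ℂ :=
  ∑ a, ∑ b, (S z)⁻¹ b a *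
    (wd a (wdbar b fun w => β w i j) z
      - ∑ m, chernConn S z a i m * wdbar b (fun w => β w m j) z
      - ∑ m, chernConn S z a j m * wdbar b (fun w => β w i m) z)

/-- `log det S₊`. -/
def logDetPlus (S : Model p q → Coeff p q) (z : Model p q) : ℂ :=
  (Real.log ((S z).toBlocks₁₁.det.re) : ℂ)

/-- `log det S₋`. -/
def logDetMinus (S : Model p q → Coeff p q) (z : Model p q) : ℂ :=
  (Real.log ((S z).toBlocks₂₂.det.re) : ℂ)

/-- The coefficients `ρ(S₊)_{i j̄}`, where `ρ(S₊) = √-1 ρ(S₊)_{i j̄} dz^i ∧ dz̄^j`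
`= -√-1 ∂∂̄ log det S₊`. -/
def rhoPlus (S : Model p q → Coeff p q) (z : Model p q) : Coeff p q := fun i j =>
  -wd i (wdbar j (logDetPlus S)) z

/-- The coefficients of `ρ(S₋) = -√-1 ∂∂̄ log det S₋`. -/
def rhoMinus (S : Model p q → Coeff p q) (z : Model p q) : Coeff p q := fun i j =>
  -wd i (wdbar j (logDetMinus S)) z

/-- The coefficients of `P(S₊, S₋) = ρ⁺(S₊) - ρ⁺(S₋) - ρ⁻(S₊) + ρ⁻(S₋)`, where the superscript
denotes the component in `Λ^{1,0}_± ∧ Λ^{0,1}_±`. -/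
def formP (S : Model p q → Coeff p q) (z : Model p q) : Coeff p q
  | Sum.inl α, Sum.inl β =>
      rhoPlus S z (Sum.inl α) (Sum.inl β) - rhoMinus S z (Sum.inl α) (Sum.inl β)
  | Sum.inr α, Sum.inr β =>
      -rhoPlus S z (Sum.inr α) (Sum.inr β) + rhoMinus S z (Sum.inr α) (Sum.inr β)
  | _, _ => 0

/-- The coefficients of `δ₊δ₊ᶜ u - δ₋δ₋ᶜ u`. -/
def boxForm (u : Model p q → ℂ) (z : Model p q) : Coeff p q
  | Sum.inl α, Sum.inl β => wd (Sum.inl α) (wdbar (Sum.inl β) u) z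
  | Sum.inr α, Sum.inr β => -wd (Sum.inr α) (wdbar (Sum.inr β) u) z
  | _, _ => 0

/-- The tensor `Ψ_{μ₊ ν₋}`. Here `H` is the background metric `h`, `S` is the background `g̃`,
while the flowing metric enters through its value `G` and its connection coefficients `A` at `z`
only; `T` denotes the torsion of `A`, lowered with `G`. -/
def Psi (H S : Model p q → Coeff p q) (z : Model p q) (G : Coeff p q) (A : ConnCoeff p q)
    (μ : Fin p) (ν : Fin q) : ℂ :=
  -- the terms in `h`
  (∑ α : Fin q, ∑ β : Fin q, (H z)⁻¹ (Sum.inr β) (Sum.inr α) *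
      covTorsion (chernConn H z) H z (Sum.inr ν) (Sum.inl μ) (Sum.inr α) (Sum.inr β))
  - (∑ α : Fin q, ∑ β : Fin q, ∑ γ : Fin p, ∑ σ : Fin p,
      (H z)⁻¹ (Sum.inr β) (Sum.inr α) * (H z)⁻¹ (Sum.inl σ) (Sum.inl γ) *
      torsion H z (Sum.inl μ) (Sum.inr ν) (Sum.inl σ) *
      torsion H z (Sum.inl γ) (Sum.inr α) (Sum.inr β))
  - (∑ α : Fin p, ∑ β : Fin p, (H z)⁻¹ (Sum.inl β) (Sum.inl α) *
      covTorsion (chernConn H z) H z (Sum.inl μ) (Sum.inr ν) (Sum.inl α) (Sum.inl β))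
  - (∑ α : Fin p, ∑ β : Fin p, ∑ γ : Fin q, ∑ σ : Fin q,
      (H z)⁻¹ (Sum.inl β) (Sum.inl α) * (H z)⁻¹ (Sum.inr σ) (Sum.inr γ) *
      torsion H z (Sum.inl μ) (Sum.inr ν) (Sum.inr σ) *
      torsion H z (Sum.inr γ) (Sum.inl α) (Sum.inl β))
  -- the terms in `g̃` and `g`
  - (∑ α : Fin q, ∑ β : Fin q, G⁻¹ (Sum.inr β) (Sum.inr α) *
      covTorsion A S z (Sum.inr ν) (Sum.inl μ) (Sum.inr α) (Sum.inr β))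
  + (∑ α : Fin q, ∑ β : Fin q, ∑ γ : Fin p, ∑ σ : Fin p,
      G⁻¹ (Sum.inr β) (Sum.inr α) * G⁻¹ (Sum.inl σ) (Sum.inl γ) *
      connTorsion G A (Sum.inl μ) (Sum.inr ν) (Sum.inl σ) *
      torsion S z (Sum.inl γ) (Sum.inr α) (Sum.inr β))
  + (∑ α : Fin p, ∑ β : Fin p, G⁻¹ (Sum.inl β) (Sum.inl α) *
      covTorsion A S z (Sum.inl μ) (Sum.inr ν) (Sum.inl α) (Sum.inl β))
  + (∑ α : Fin p, ∑ β : Fin p, ∑ γ : Fin q, ∑ σ : Fin q,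
      G⁻¹ (Sum.inl β) (Sum.inl α) * G⁻¹ (Sum.inr σ) (Sum.inr γ) *
      connTorsion G A (Sum.inl μ) (Sum.inr ν) (Sum.inr σ) *
      torsion S z (Sum.inr γ) (Sum.inl α) (Sum.inl β))
  + (∑ α : Fin q, ∑ β : Fin q, ∑ γ : Fin p, ∑ δ : Fin p,
      G⁻¹ (Sum.inr β) (Sum.inr α) * G⁻¹ (Sum.inl γ) (Sum.inl δ) *
      connTorsion G A (Sum.inr α) (Sum.inl μ) (Sum.inl γ) *
      torsion S z (Sum.inl δ) (Sum.inr ν) (Sum.inr β))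
  - (∑ α : Fin p, ∑ β : Fin p, ∑ γ : Fin q, ∑ δ : Fin q,
      G⁻¹ (Sum.inl β) (Sum.inl α) * G⁻¹ (Sum.inr γ) (Sum.inr δ) *
      connTorsion G A (Sum.inl α) (Sum.inr ν) (Sum.inr γ) *
      torsion S z (Sum.inr δ) (Sum.inl μ) (Sum.inl β))

end Local

/-! ### Generalized Kähler manifolds -/

section Global

variable {p q : ℕ} {M : Type*} [TopologicalSpace M] [ChartedSpace (Model p q) M]

variable (p q M) in
/-- Fields of endomorphisms of the tangent bundle. -/
abbrev EndField : Type _ :=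
  ∀ x : M, TangentSpace 𝓘(ℝ, Model p q) x →L[ℝ] TangentSpace 𝓘(ℝ, Model p q) x

variable (p q M) in
/-- Smooth Riemannian metrics on `M`. -/
abbrev Metric [IsManifold 𝓘(ℝ, Model p q) ∞ M] : Type _ :=
  Bundle.ContMDiffRiemannianMetric 𝓘(ℝ, Model p q) ∞ (Model p q)
    (fun x : M => TangentSpace 𝓘(ℝ, Model p q) x)

/-- The endomorphism field `J` read in the chart `φ`. -/
def chartEnd (φ : OpenPartialHomeomorph M (Model p q)) (J : EndField p q M) (z : Model p q) :
    Model p q →L[ℝ] Model p q :=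
  (show TangentSpace 𝓘(ℝ, Model p q) (φ.symm z) →L[ℝ] Model p q from
      mfderiv 𝓘(ℝ, Model p q) 𝓘(ℝ, Model p q) φ (φ.symm z)).comp
    ((J (φ.symm z)).comp
      (show Model p q →L[ℝ] TangentSpace 𝓘(ℝ, Model p q) (φ.symm z) from
        mfderiv 𝓘(ℝ, Model p q) 𝓘(ℝ, Model p q) φ.symm z))

/-- A field of bilinear forms read in the chart `φ`. -/
def chartBilin (φ : OpenPartialHomeomorph M (Model p q))
    (b : ∀ x : M, TangentSpace 𝓘(ℝ, Model p q) x →L[ℝ] TangentSpace 𝓘(ℝ, Model p q) x →L[ℝ] ℝ)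
    (z : Model p q) : Model p q →L[ℝ] Model p q →L[ℝ] ℝ :=
  ContinuousLinearMap.bilinearComp
    (show Model p q →L[ℝ] Model p q →L[ℝ] ℝ from b (φ.symm z))
    (show Model p q →L[ℝ] Model p q from mfderiv 𝓘(ℝ, Model p q) 𝓘(ℝ, Model p q) φ.symm z)
    (show Model p q →L[ℝ] Model p q from mfderiv 𝓘(ℝ, Model p q) 𝓘(ℝ, Model p q) φ.symm z)

/-- The 2-form with values `(B(u,v) - B(v,u)) / 2`; this is `B` itself if `B` is antisymmetric. -/
def toTwoForm (B : Model p q →L[ℝ] Model p q →L[ℝ] ℝ) : Model p q [⋀^Fin 2]→L[ℝ] ℝ :=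
  (1 / 2 : ℝ) • ContinuousAlternatingMap.alternatizeUncurryFin
    (((ContinuousAlternatingMap.ofSubsingletonLIE (𝕜 := ℝ) (E := Model p q) (F := ℝ)
      (0 : Fin 1)
      ).toContinuousLinearEquiv.toContinuousLinearMap).comp B)

theorem toTwoForm_apply (B : Model p q →L[ℝ] Model p q →L[ℝ] ℝ) (u v : Model p q)
    (h : B v u = -B u v) : toTwoForm B ![u, v] = B u v := by
  simp [toTwoForm, ContinuousAlternatingMap.alternatizeUncurryFin_apply, Fin.sum_univ_two,
    Fin.removeNth, h]
  ring

/-- The metric `g` is compatible with `J`. -/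
def IsHermitian [IsManifold 𝓘(ℝ, Model p q) ∞ M] (g : Metric p q M) (J : EndField p q M) : Prop :=
  ∀ (x : M) (u v : TangentSpace 𝓘(ℝ, Model p q) x), g.inner x (J x u) (J x v) = g.inner x u v

/-- The Kähler form `ω = g(J·,·)` read in the chart `φ`. -/
def kahlerForm [IsManifold 𝓘(ℝ, Model p q) ∞ M] (φ : OpenPartialHomeomorph M (Model p q))
    (g : Metric p q M) (J : EndField p q M) (z : Model p q) : Model p q [⋀^Fin 2]→L[ℝ] ℝ :=
  toTwoForm (chartBilin φ (fun x => (g.inner x).comp (J x)) z)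

/-- `dᶜη = √-1 (∂̄ - ∂)η` for a form `η` of type `(1,1)` with respect to `J`, that is,
`dᶜη(X,Y,Z) = -dη(JX,JY,JZ)`, read in the chart `φ`. -/
def dc (φ : OpenPartialHomeomorph M (Model p q)) (J : EndField p q M)
    (η : Model p q → Model p q [⋀^Fin 2]→L[ℝ] ℝ) (z : Model p q) :
    Model p q [⋀^Fin 3]→L[ℝ] ℝ :=
  -(extDeriv η z).compContinuousLinearMap (chartEnd φ J z)

/-- `J` is an integrable complex structure: it is smooth, `J² = -1`, and the Nijenhuis tensor
`[JX,JY] - J[JX,Y] - J[X,JY] - [X,Y]` vanishes (on constant vector fields in charts, for which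
`[X,Y] = 0`). -/
structure IsComplexStructure [IsManifold 𝓘(ℝ, Model p q) ∞ M] (J : EndField p q M) : Prop where
  smooth : ContMDiff 𝓘(ℝ, Model p q)
    (𝓘(ℝ, Model p q).prod 𝓘(ℝ, Model p q →L[ℝ] Model p q)) ∞
    (fun x : M => Bundle.TotalSpace.mk' (Model p q →L[ℝ] Model p q)
      (E := fun y : M => TangentSpace 𝓘(ℝ, Model p q) y →L[ℝ] TangentSpace 𝓘(ℝ, Model p q) y)
      x (J x))
  sq : ∀ (x : M) (v : TangentSpace 𝓘(ℝ, Model p q) x), J x (J x v) = -v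
  nijenhuis : ∀ φ ∈ IsManifold.maximalAtlas 𝓘(ℝ, Model p q) ∞ M, ∀ z ∈ φ.target,
    ∀ X Y : Model p q,
    VectorField.lieBracket ℝ (fun w => chartEnd φ J w X) (fun w => chartEnd φ J w Y) z
      = chartEnd φ J z (VectorField.lieBracket ℝ (fun w => chartEnd φ J w X) (fun _ => Y) z)
      + chartEnd φ J z (VectorField.lieBracket ℝ (fun _ => X) (fun w => chartEnd φ J w Y) z)

/-- `(g, J₊, J₋)` is a generalized Kähler structure:
`d₊ᶜω₊ = -d₋ᶜω₋` and `d d₊ᶜω₊ = -d d₋ᶜω₋ = 0`. -/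
structure IsGeneralizedKahler [IsManifold 𝓘(ℝ, Model p q) ∞ M] (g : Metric p q M)
    (Jp Jm : EndField p q M) : Prop where
  complex_plus : IsComplexStructure Jp
  complex_minus : IsComplexStructure Jm
  hermitian_plus : IsHermitian g Jp
  hermitian_minus : IsHermitian g Jm
  dc_eq : ∀ φ ∈ IsManifold.maximalAtlas 𝓘(ℝ, Model p q) ∞ M, ∀ z ∈ φ.target,
    dc φ Jp (kahlerForm φ g Jp) z = -dc φ Jm (kahlerForm φ g Jm) z
  ddc_plus : ∀ φ ∈ IsManifold.maximalAtlas 𝓘(ℝ, Model p q) ∞ M, ∀ z ∈ φ.target,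
    extDeriv (dc φ Jp (kahlerForm φ g Jp)) z = 0
  ddc_minus : ∀ φ ∈ IsManifold.maximalAtlas 𝓘(ℝ, Model p q) ∞ M, ∀ z ∈ φ.target,
    extDeriv (dc φ Jm (kahlerForm φ g Jm)) z = 0

/-- Adapted local coordinates: a chart that is holomorphic for `J₊` and in which
`T₊ = ker (J₊ + J₋)` and `T₋ = ker (J₊ - J₋)` are the tangent spaces of the factors `ℂ^p` and `ℂ^q`;
that is, `J₊ = (√-1, √-1)` and `J₋ = (-√-1, √-1)` on `ℂ^p × ℂ^q`. -/
structure IsAdapted [IsManifold 𝓘(ℝ, Model p q) ∞ M] (Jp Jm : EndField p q M)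
    (φ : OpenPartialHomeomorph M (Model p q)) : Prop where
  mem_atlas : φ ∈ IsManifold.maximalAtlas 𝓘(ℝ, Model p q) ∞ M
  plus : ∀ z ∈ φ.target, ∀ v : Model p q, chartEnd φ Jp z v = fun i => Complex.I * v i
  minus : ∀ z ∈ φ.target, ∀ v : Model p q, chartEnd φ Jm z v =
    Sum.elim (fun α => -(Complex.I * v (Sum.inl α))) (fun α => Complex.I * v (Sum.inr α))

/-- The coefficients `g_{i j̄} = g(∂/∂z_i, ∂/∂z̄_j)` of the complex bilinear extension of `g` in the
chart `φ`; thus `ω = √-1 g_{i j̄} dz^i ∧ dz̄^j`. -/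
def coeff [IsManifold 𝓘(ℝ, Model p q) ∞ M] (φ : OpenPartialHomeomorph M (Model p q))
    (g : Metric p q M) (z : Model p q) : Coeff p q := fun i j =>
  let b := chartBilin φ g.inner z
  (1 / 4 : ℂ) *
    ((b (Pi.single i 1) (Pi.single j 1) + b (Pi.single i Complex.I) (Pi.single j Complex.I) : ℝ)
      + Complex.I *
        (b (Pi.single i 1) (Pi.single j Complex.I) - b (Pi.single i Complex.I) (Pi.single j 1) : ℝ))

/-- A real function read in the chart `φ`. -/
def chartFun (φ : OpenPartialHomeomorph M (Model p q)) (u : M → ℝ) (z : Model p q) : ℂ :=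
  (u (φ.symm z) : ℂ)

/-- The coefficients of the background `ω̃_t = ω_0 - t P(h)`, where `g0` is the metric of `ω_0`. -/
def background [IsManifold 𝓘(ℝ, Model p q) ∞ M] (φ : OpenPartialHomeomorph M (Model p q))
    (g0 h : Metric p q M) (t : ℝ) (z : Model p q) : Coeff p q :=
  coeff φ g0 z - (t : ℂ) • formP (coeff φ h) z

/-- The family `f` is, on `[0, T)`, a smooth solution of the scalar flow
`∂f/∂t = log (det g₊ det h₋ / (det h₊ det g₋))`, `f(0) = 0`, where `g = g_t` is the family of
metrics, compatible with `J₊` and `J₋`, with `ω_t = ω_0 - t P(h) + (δ₊δ₊ᶜ - δ₋δ₋ᶜ) f_t`. -/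
structure IsPotentialFlow [IsManifold 𝓘(ℝ, Model p q) ∞ M] (Jp Jm : EndField p q M)
    (h : Metric p q M) (g : ℝ → Metric p q M) (f : ℝ → M → ℝ) (T : ℝ) : Prop where
  smooth : ContMDiffOn (𝓘(ℝ, ℝ).prod 𝓘(ℝ, Model p q)) 𝓘(ℝ, ℝ) ∞
    (fun y : ℝ × M => f y.1 y.2) (Ico 0 T ×ˢ univ)
  initial : ∀ x, f 0 x = 0
  hermitian_plus : ∀ t ∈ Ico 0 T, IsHermitian (g t) Jp
  hermitian_minus : ∀ t ∈ Ico 0 T, IsHermitian (g t) Jm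
  metric_eq : ∀ t ∈ Ico 0 T, ∀ φ : OpenPartialHomeomorph M (Model p q), IsAdapted Jp Jm φ →
    ∀ z ∈ φ.target,
      coeff φ (g t) z = background φ (g 0) h t z + boxForm (chartFun φ (f t)) z
  evolution : ∀ t ∈ Ico 0 T, ∀ φ : OpenPartialHomeomorph M (Model p q), IsAdapted Jp Jm φ →
    ∀ z ∈ φ.target,
      HasDerivWithinAt (fun s => f s (φ.symm z))
        (Real.log
          (((coeff φ (g t) z).toBlocks₁₁.det.re * (coeff φ h z).toBlocks₂₂.det.re) /
            ((coeff φ h z).toBlocks₁₁.det.re * (coeff φ (g t) z).toBlocks₂₂.det.re)))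
        (Ico 0 T) t

end Global

end SplitGK

end

/-! Applying `∂_{ν₋} ∂_{μ₊}` to the scalar flow reduces the evolution equation to the mixed Hessians
of `log det` of the blocks of `g` and `h`. For a matrix `A` such a Hessian is `A^{b̄ a} (∂_i ∂_j
A_{a b̄} - Γ_{i a}^m ∂_j A_{m b̄})` (`wd_wd_log_det`). With the contracting metric and its `Γ` held
fixed, this is linear in the coefficients being differentiated. Since `g = g̃ + box f`, the Hessian
for `g` therefore splits into a part in `f` and a part in `g̃`.

The part in `f` is almost the Laplacian. Along `T₊` and along `T₋` the metric `g` has no torsion, so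
`Γ` is symmetric in pure directions, and the only terms of `Δ ∂₋∂₊ f` left over are `crossPlus` and
`crossMinus`, where `Γ` has one lower index of each type (`chernLaplacian_torsionPotential`).
Evaluated on `box f = g - g̃`, each of them is quadratic in the derivatives of `g`. But the two
cross terms of `g` with itself coincide (`crossPlus_self`), so their difference only involves `g̃`.
This cancellation is what leaves `Ψ` affine in `Γ`.

The traces of `∇T` in `Ψ`, together with the first products of torsions, recombine into the same
Hessian traces (`trace_covTorsion_minus`, `trace_covTorsion_plus`), and the last two products are
the cross terms of `g̃`. This is `Psi_eq`.

The pure torsion of `g` vanishes because `J₋ = ±J₊` on `T_∓`: for either sign the restrictions of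
`d₊ᶜω₊` and `d₋ᶜω₋` agree, so `d₊ᶜω₊ = -d₋ᶜω₋` makes them zero for `g₀` (`torsion_coeff_eq_zero`),
while `P(h)` and `box f` contribute nothing since derivatives commute.

Finally, every term of `Ψ` contains a torsion of `h` or `g̃`, or its covariant derivative, and at
most one factor depending on the connection of `g`; affinity and the Kähler case follow. -/

noncomputable section

namespace SplitGK

/-! ### Wirtinger calculus on open sets. -/

section Calculus

variable {p q : ℕ} {U : Set (Model p q)} {z : Model p q} {u v : Model p q → ℂ}

/-- The complex first-order operator `(∂_a + c ∂_b) / 2` with constant coefficients. -/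
def dirDeriv (a b : Model p q) (c : ℂ) (u : Model p q → ℂ) (z : Model p q) : ℂ :=
  (1 / 2) * (fderiv ℝ u z a + c * fderiv ℝ u z b)

/-- Both Wirtinger derivatives are cases of `dirDeriv`, with `c = -√-1` and `c = √-1`, so the
product rule and the commutation of all pairs `∂∂`, `∂∂̄` need only one proof. -/
theorem wd_eq_dirDeriv (i : Fin p ⊕ Fin q) :
    wd (p := p) (q := q) i = dirDeriv (Pi.single i 1) (Pi.single i Complex.I) (-Complex.I) := by
  funext u z
  simp only [wd, dirDeriv]
  ring

theorem wdbar_eq_dirDeriv (i : Fin p ⊕ Fin q) :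
    wdbar (p := p) (q := q) i = dirDeriv (Pi.single i 1) (Pi.single i Complex.I) Complex.I :=
  rfl

theorem differentiableAt_of_contDiffOn (hU : IsOpen U) (hu : ContDiffOn ℝ ∞ u U) (hz : z ∈ U) :
    DifferentiableAt ℝ u z :=
  (hu.contDiffAt (hU.mem_nhds hz)).differentiableAt (by simp)

section DirDeriv

variable {a b : Model p q} {c : ℂ}

theorem dirDeriv_congr (hU : IsOpen U) (hz : z ∈ U) (h : ∀ w ∈ U, u w = v w) :
    dirDeriv a b c u z = dirDeriv a b c v z := by
  have : u =ᶠ[𝓝 z] v := Filter.eventually_of_mem (hU.mem_nhds hz) h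
  simp only [dirDeriv, this.fderiv_eq]

theorem dirDeriv_const (k : ℂ) : dirDeriv a b c (fun _ => k) z = 0 := by
  simp [dirDeriv]

theorem dirDeriv_add (hu : DifferentiableAt ℝ u z) (hv : DifferentiableAt ℝ v z) :
    dirDeriv a b c (fun w => u w + v w) z = dirDeriv a b c u z + dirDeriv a b c v z := by
  simp only [dirDeriv, fderiv_fun_add hu hv, add_apply]
  ring

theorem dirDeriv_neg : dirDeriv a b c (fun w => -u w) z = -dirDeriv a b c u z := by
  simp only [dirDeriv, fderiv_fun_neg, neg_apply]
  ring

theorem dirDeriv_sub (hu : DifferentiableAt ℝ u z) (hv : DifferentiableAt ℝ v z) :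
    dirDeriv a b c (fun w => u w - v w) z = dirDeriv a b c u z - dirDeriv a b c v z := by
  simp only [dirDeriv, fderiv_fun_sub hu hv, sub_apply]
  ring

theorem dirDeriv_mul (hu : DifferentiableAt ℝ u z) (hv : DifferentiableAt ℝ v z) :
    dirDeriv a b c (fun w => u w * v w) z
      = dirDeriv a b c u z * v z + u z * dirDeriv a b c v z := by
  simp only [dirDeriv, fderiv_fun_mul hu hv, add_apply,
    smul_apply, smul_eq_mul]
  ring

theorem dirDeriv_sum {ι : Type*} (s : Finset ι) {f : ι → Model p q → ℂ}
    (hf : ∀ i ∈ s, DifferentiableAt ℝ (f i) z) :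
    dirDeriv a b c (fun w => ∑ i ∈ s, f i w) z = ∑ i ∈ s, dirDeriv a b c (f i) z := by
  simp only [dirDeriv, fderiv_fun_sum hf, sum_apply, Finset.mul_sum,
    Finset.sum_add_distrib, mul_add]

theorem dirDeriv_contDiffOn (hU : IsOpen U) (hu : ContDiffOn ℝ ∞ u U) :
    ContDiffOn ℝ ∞ (dirDeriv a b c u) U := by
  have h : ContDiffOn ℝ ∞ (fderiv ℝ u) U := hu.fderiv_of_isOpen hU (by simp)
  have h1 : ∀ x : Model p q, ContDiffOn ℝ ∞ (fun w => fderiv ℝ u w x) U := fun x =>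
    h.clm_apply contDiffOn_const
  exact contDiffOn_const.mul ((h1 a).add (contDiffOn_const.mul (h1 b)))

theorem dirDeriv_comm {a' b' : Model p q} {c' : ℂ} (hU : IsOpen U) (hz : z ∈ U)
    (hu : ContDiffOn ℝ ∞ u U) :
    dirDeriv a b c (dirDeriv a' b' c' u) z = dirDeriv a' b' c' (dirDeriv a b c u) z := by
  have hd : DifferentiableAt ℝ (fderiv ℝ u) z :=
    ((hu.fderiv_of_isOpen (m := ∞) hU (by simp)).contDiffAt
      (hU.mem_nhds hz)).differentiableAt (by simp)
  have hsymm : IsSymmSndFDerivAt ℝ u z :=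
    (hu.contDiffAt (hU.mem_nhds hz)).isSymmSndFDerivAt
      (by simp only [minSmoothness_of_isRCLikeNormedField]; exact WithTop.coe_le_coe.2 le_top)
  have hx : ∀ x y : Model p q, fderiv ℝ (fun w => fderiv ℝ u w x) z y
      = fderiv ℝ (fderiv ℝ u) z y x := by
    intro x y
    rw [fderiv_clm_apply hd (differentiableAt_const x)]
    simp
  have hdx : ∀ x : Model p q, DifferentiableAt ℝ (fun w => fderiv ℝ u w x) z := fun x =>
    hd.clm_apply (differentiableAt_const x)
  -- Everything is expanded into the second real differential, whose symmetry then gives the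
  -- commutation.
  have key : ∀ (a b : Model p q) (c : ℂ) (y : Model p q), fderiv ℝ (dirDeriv a b c u) z y
      = (1 / 2) * (fderiv ℝ (fderiv ℝ u) z y a + c * fderiv ℝ (fderiv ℝ u) z y b) := by
    intro a b c y
    unfold dirDeriv
    have h2 : DifferentiableAt ℝ (fun w => c * fderiv ℝ u w b) z := (hdx b).const_mul c
    have h3 : DifferentiableAt ℝ (fun w => fderiv ℝ u w a + c * fderiv ℝ u w b) z := (hdx a).add h2
    rw [fderiv_const_mul h3, fderiv_fun_add (hdx a) h2, fderiv_const_mul (hdx b)]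
    simp [hx, mul_add]
  rw [dirDeriv, dirDeriv, key, key, key, key, hsymm.eq a' a, hsymm.eq a' b, hsymm.eq b' a,
    hsymm.eq b' b]
  ring

end DirDeriv

variable (i j : Fin p ⊕ Fin q)

theorem wd_congr (hU : IsOpen U) (hz : z ∈ U) (h : ∀ w ∈ U, u w = v w) :
    wd i u z = wd i v z := by
  simpa only [wd_eq_dirDeriv] using dirDeriv_congr hU hz h

theorem wd_const (k : ℂ) : wd i (fun _ => k) z = 0 := by
  simp [wd_eq_dirDeriv, dirDeriv_const]

theorem wdbar_const (k : ℂ) : wdbar i (fun _ => k) z = 0 := by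
  simp [wdbar_eq_dirDeriv, dirDeriv_const]

theorem wd_add (hu : DifferentiableAt ℝ u z) (hv : DifferentiableAt ℝ v z) :
    wd i (fun w => u w + v w) z = wd i u z + wd i v z := by
  simpa only [wd_eq_dirDeriv] using dirDeriv_add hu hv

theorem wd_sub (hu : DifferentiableAt ℝ u z) (hv : DifferentiableAt ℝ v z) :
    wd i (fun w => u w - v w) z = wd i u z - wd i v z := by
  simpa only [wd_eq_dirDeriv] using dirDeriv_sub hu hv

theorem wd_neg : wd i (fun w => -u w) z = -wd i u z := by
  simpa only [wd_eq_dirDeriv] using dirDeriv_neg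

theorem wdbar_neg : wdbar i (fun w => -u w) z = -wdbar i u z :=
  dirDeriv_neg

theorem wd_mul (hu : DifferentiableAt ℝ u z) (hv : DifferentiableAt ℝ v z) :
    wd i (fun w => u w * v w) z = wd i u z * v z + u z * wd i v z := by
  simpa only [wd_eq_dirDeriv] using dirDeriv_mul hu hv

theorem wd_sum {ι : Type*} (s : Finset ι) {f : ι → Model p q → ℂ}
    (hf : ∀ i ∈ s, DifferentiableAt ℝ (f i) z) :
    wd i (fun w => ∑ k ∈ s, f k w) z = ∑ k ∈ s, wd i (f k) z := by
  simpa only [wd_eq_dirDeriv] using dirDeriv_sum s hf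

theorem wd_contDiffOn (hU : IsOpen U) (hu : ContDiffOn ℝ ∞ u U) :
    ContDiffOn ℝ ∞ (wd i u) U := by
  simpa only [wd_eq_dirDeriv] using dirDeriv_contDiffOn hU hu

theorem wdbar_contDiffOn (hU : IsOpen U) (hu : ContDiffOn ℝ ∞ u U) :
    ContDiffOn ℝ ∞ (wdbar i u) U :=
  dirDeriv_contDiffOn hU hu

theorem wd_comm (hU : IsOpen U) (hz : z ∈ U) (hu : ContDiffOn ℝ ∞ u U) :
    wd i (wd j u) z = wd j (wd i u) z := by
  simpa only [wd_eq_dirDeriv] using dirDeriv_comm hU hz hu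

theorem wd_wdbar_comm (hU : IsOpen U) (hz : z ∈ U) (hu : ContDiffOn ℝ ∞ u U) :
    wd i (wdbar j u) z = wdbar j (wd i u) z := by
  simpa only [wd_eq_dirDeriv, wdbar_eq_dirDeriv] using dirDeriv_comm hU hz hu

end Calculus

/-! ### Derivatives of determinants, inverses and `log det`. -/

section Determinants

variable {p q : ℕ} {ι : Type*} [Fintype ι] [DecidableEq ι] {U : Set (Model p q)}
  {z : Model p q} {A : Model p q → Matrix ι ι ℂ}

theorem det_contDiffOn (hA : ∀ a b, ContDiffOn ℝ ∞ (fun w => A w a b) U) :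
    ContDiffOn ℝ ∞ (fun w => (A w).det) U := by
  simp only [Matrix.det_apply]
  refine ContDiffOn.sum fun σ _ => ?_
  exact (contDiffOn_prod fun k _ => hA _ _).const_smul _

theorem inv_contDiffOn (hA : ∀ a b, ContDiffOn ℝ ∞ (fun w => A w a b) U)
    (hdet : ∀ w ∈ U, (A w).det ≠ 0) (a b : ι) :
    ContDiffOn ℝ ∞ (fun w => (A w)⁻¹ a b) U := by
  -- By Cramer's rule an entry of the inverse is a quotient of determinants with smooth entries.
  have h : (fun w => (A w)⁻¹ a b)
      = fun w => ((A w).det)⁻¹ * ((A w).updateRow b (Pi.single a 1)).det := by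
    funext w
    simp [Matrix.inv_def, Matrix.adjugate_apply]
  rw [h]
  refine ((det_contDiffOn hA).inv hdet).mul (det_contDiffOn fun c d => ?_)
  by_cases hc : c = b
  · subst hc
    simpa using contDiffOn_const
  · simpa [Matrix.updateRow_ne hc] using hA c d

/-- Jacobi's formula. -/
theorem fderiv_det (hA : ∀ a b, DifferentiableAt ℝ (fun w => A w a b) z) (x : Model p q) :
    fderiv ℝ (fun w => (A w).det) z x
      = ∑ a, ∑ b, (A z).adjugate b a * fderiv ℝ (fun w => A w a b) z x := by
  let D : ContinuousMultilinearMap ℂ (fun _ : ι => ι → ℂ) ℂ :=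
    ⟨(Matrix.detRowAlternating (R := ℂ) (n := ι)).toMultilinearMap,
      Continuous.matrix_det (A := fun B : Matrix ι ι ℂ => B) continuous_id⟩
  have hrow : ∀ a, HasFDerivAt (fun w => (A w a : ι → ℂ))
      (ContinuousLinearMap.pi fun b => fderiv ℝ (fun w => A w a b) z) z := fun a =>
    hasFDerivAt_pi.2 fun b => (hA a b).hasFDerivAt
  have hmat : HasFDerivAt (fun w => (A w : ι → ι → ℂ))
      (ContinuousLinearMap.pi fun a => ContinuousLinearMap.pi fun b =>
        fderiv ℝ (fun w => A w a b) z) z :=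
    hasFDerivAt_pi.2 hrow
  have hD := ((D.hasFDerivAt (A z : ι → ι → ℂ)).restrictScalars ℝ).comp z hmat
  have hdet : HasFDerivAt (fun w => (A w).det) _ z := hD
  rw [hdet.fderiv]
  -- The determinant is multilinear in the rows, so its derivative is a sum of determinants with one
  -- row replaced by its derivative; Cramer's rule turns each into a row of the adjugate.
  refine (D.linearDeriv_apply _ _).trans ?_
  refine Finset.sum_congr rfl fun a _ => ?_
  have h := Matrix.cramer_transpose_apply (A z) (fun b => fderiv ℝ (fun w => A w a b) z x) a
  rw [Matrix.cramer_eq_adjugate_mulVec, ← Matrix.adjugate_transpose] at h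
  exact h.symm

theorem wd_det (i : Fin p ⊕ Fin q) (hA : ∀ a b, DifferentiableAt ℝ (fun w => A w a b) z) :
    wd i (fun w => (A w).det) z
      = ∑ a, ∑ b, (A z).adjugate b a * wd i (fun w => A w a b) z := by
  simp only [wd, fderiv_det hA, Finset.mul_sum, ← Finset.sum_sub_distrib]
  refine Finset.sum_congr rfl fun a _ => Finset.sum_congr rfl fun b _ => ?_
  ring

/-- As `d` is real on an open set, its imaginary part has zero differential there. Taking the real
part inside the logarithm thus does not disturb the usual logarithmic derivative. -/
theorem fderiv_log_re (hU : IsOpen U) (hz : z ∈ U) {d : Model p q → ℂ}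
    (hd : DifferentiableAt ℝ d z) (hre : ∀ w ∈ U, 0 < (d w).re) (him : ∀ w ∈ U, (d w).im = 0)
    (x : Model p q) :
    fderiv ℝ (fun w => (Real.log (d w).re : ℂ)) z x = (d z)⁻¹ * fderiv ℝ d z x := by
  have h1 : HasFDerivAt (fun w => (d w).re) (Complex.reCLM.comp (fderiv ℝ d z)) z :=
    Complex.reCLM.hasFDerivAt.comp z hd.hasFDerivAt
  have h2 : HasFDerivAt (fun w => (d w).im) (Complex.imCLM.comp (fderiv ℝ d z)) z :=
    Complex.imCLM.hasFDerivAt.comp z hd.hasFDerivAt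
  have h3 : Complex.imCLM.comp (fderiv ℝ d z) = 0 := by
    have h4 : (fun w => (d w).im) =ᶠ[𝓝 z] fun _ => 0 :=
      Filter.eventually_of_mem (hU.mem_nhds hz) him
    rw [← h2.fderiv, h4.fderiv_eq]
    simp
  have h5 : (fderiv ℝ d z x).im = 0 := by simpa using congrArg (fun L => L x) h3
  have h6 := Complex.ofRealCLM.hasFDerivAt.comp z (h1.log (hre z hz).ne')
  have h7 : HasFDerivAt (fun w => (Real.log (d w).re : ℂ)) _ z := h6
  have h8 : d z = ((d z).re : ℂ) := Complex.ext rfl (by simpa using him z hz)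
  have h9 : fderiv ℝ d z x = ((fderiv ℝ d z x).re : ℂ) := Complex.ext rfl (by simpa using h5)
  rw [h7.fderiv, h8, h9]
  simp

theorem wd_log_det (i : Fin p ⊕ Fin q) (hU : IsOpen U) (hz : z ∈ U)
    (hA : ∀ a b, ContDiffOn ℝ ∞ (fun w => A w a b) U)
    (hre : ∀ w ∈ U, 0 < (A w).det.re) (him : ∀ w ∈ U, (A w).det.im = 0) :
    wd i (fun w => (Real.log (A w).det.re : ℂ)) z
      = ∑ a, ∑ b, (A z)⁻¹ b a * wd i (fun w => A w a b) z := by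
  have hdet := differentiableAt_of_contDiffOn hU (det_contDiffOn hA) hz
  have h := wd_det i fun a b => differentiableAt_of_contDiffOn hU (hA a b) hz
  have h1 : wd i (fun w => (Real.log (A w).det.re : ℂ)) z
      = (A z).det⁻¹ * wd i (fun w => (A w).det) z := by
    simp only [wd, fderiv_log_re hU hz hdet hre him]
    ring
  rw [h1, h]
  simp only [Matrix.inv_def, Matrix.smul_apply, Ring.inverse_eq_inv', smul_eq_mul, Finset.mul_sum,
    mul_assoc]

theorem log_det_contDiffOn (hA : ∀ a b, ContDiffOn ℝ ∞ (fun w => A w a b) U)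
    (hre : ∀ w ∈ U, 0 < (A w).det.re) :
    ContDiffOn ℝ ∞ (fun w => (Real.log (A w).det.re : ℂ)) U :=
  Complex.ofRealCLM.contDiff.comp_contDiffOn
    ((Complex.reCLM.contDiff.comp_contDiffOn (det_contDiffOn hA)).log fun w hw => (hre w hw).ne')

theorem wd_inv (i : Fin p ⊕ Fin q) (hU : IsOpen U) (hz : z ∈ U)
    (hA : ∀ a b, ContDiffOn ℝ ∞ (fun w => A w a b) U)
    (hdet : ∀ w ∈ U, (A w).det ≠ 0) (a b : ι) :
    wd i (fun w => (A w)⁻¹ b a) z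
      = -∑ c, ∑ d, (A z)⁻¹ b c * wd i (fun w => A w c d) z * (A z)⁻¹ d a := by
  have hAd := fun a b => differentiableAt_of_contDiffOn hU (hA a b) hz
  have hId := fun a b => differentiableAt_of_contDiffOn hU (inv_contDiffOn hA hdet a b) hz
  let X : Matrix ι ι ℂ := fun c d => wd i (fun w => (A w)⁻¹ c d) z
  let Y : Matrix ι ι ℂ := fun c d => wd i (fun w => A w c d) z
  -- This is the derivative of `A⁻¹ A = 1`, an identity valid on a neighbourhood.
  have h : X * A z + (A z)⁻¹ * Y = 0 := by
    ext c d
    have h1 : ∀ w ∈ U, ∑ k, (A w)⁻¹ c k * A w k d = (1 : Matrix ι ι ℂ) c d := by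
      intro w hw
      rw [← Matrix.mul_apply, Matrix.nonsing_inv_mul _ (isUnit_iff_ne_zero.2 (hdet w hw))]
    have h2 := wd_congr i hU hz h1
    rw [wd_const, wd_sum i _ fun k _ => (hId c k).fun_mul (hAd k d)] at h2
    simp only [wd_mul i (hId _ _) (hAd _ _), Finset.sum_add_distrib] at h2
    simpa [Matrix.mul_apply] using h2
  have h3 : X = -((A z)⁻¹ * Y * (A z)⁻¹) := by
    have h4 : X * A z * (A z)⁻¹ = X :=
      Matrix.mul_nonsing_inv_cancel_right _ _ (isUnit_iff_ne_zero.2 (hdet z hz))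
    rw [← h4, eq_neg_of_add_eq_zero_left h, Matrix.neg_mul]
  have h5 := congrFun (congrFun h3 b) a
  simp only [Matrix.neg_apply, Matrix.mul_apply, Finset.sum_mul] at h5
  rw [show wd i (fun w => (A w)⁻¹ b a) z = X b a from rfl, h5, Finset.sum_comm]

/-- The mixed second derivative of `log det A`. -/
theorem wd_wd_log_det (i j : Fin p ⊕ Fin q) (hU : IsOpen U) (hz : z ∈ U)
    (hA : ∀ a b, ContDiffOn ℝ ∞ (fun w => A w a b) U)
    (hre : ∀ w ∈ U, 0 < (A w).det.re) (him : ∀ w ∈ U, (A w).det.im = 0) :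
    wd i (wd j (fun w => (Real.log (A w).det.re : ℂ))) z
      = ∑ a, ∑ b, (A z)⁻¹ b a * (wd i (wd j (fun w => A w a b)) z
          - ∑ m, (∑ d, wd i (fun w => A w a d) z * (A z)⁻¹ d m) * wd j (fun w => A w m b) z) := by
  have hdet : ∀ w ∈ U, (A w).det ≠ 0 := fun w hw h => by simpa [h] using hre w hw
  have hId := fun a b => differentiableAt_of_contDiffOn hU (inv_contDiffOn hA hdet a b) hz
  have hAd := fun a b => differentiableAt_of_contDiffOn hU (wd_contDiffOn j hU (hA a b)) hz
  rw [wd_congr i hU hz fun w hw => wd_log_det j hU hw hA hre him,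
    wd_sum i _ fun a _ => DifferentiableAt.fun_sum fun b _ => (hId b a).fun_mul (hAd a b)]
  simp only [wd_sum i _ fun b _ => (hId b _).fun_mul (hAd _ b), wd_mul i (hId _ _) (hAd _ _),
    wd_inv i hU hz hA hdet, Finset.sum_add_distrib, mul_sub, Finset.sum_sub_distrib]
  rw [add_comm, sub_eq_add_neg]
  congr 1
  simp only [neg_mul, Finset.sum_neg_distrib, neg_inj, Finset.sum_mul, Finset.mul_sum]
  -- The two sides differ by the names of two summation indices: the row index of the factor
  -- differentiated by `∂_j` and that of the factor differentiated by `∂_i`.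
  have e : ∀ F : ι → ι → ι → ι → ℂ,
      ∑ a, ∑ b, ∑ c, ∑ d, F a b c d = ∑ c, ∑ b, ∑ a, ∑ d, F a b c d := by
    intro F
    rw [Finset.sum_comm]
    simp only [Finset.sum_comm (s := Finset.univ) (t := Finset.univ)
      (f := fun a c => ∑ d, F a _ c d)]
    rw [Finset.sum_comm]
  rw [e]
  refine Finset.sum_congr rfl fun a _ => Finset.sum_congr rfl fun b _ =>
    Finset.sum_congr rfl fun c _ => Finset.sum_congr rfl fun d _ => ?_
  ring

end Determinants

/-! ### Metrics respecting `T₊ ⊕ T₋`: connection, torsion and traced Hessians. -/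

section SplitMetrics

variable {p q : ℕ} {U : Set (Model p q)} {z : Model p q} {S G : Model p q → Coeff p q}

/-- `S` is smooth on `U` and respects the splitting `T₊ ⊕ T₋`. -/
structure IsSplitOn (S : Model p q → Coeff p q) (U : Set (Model p q)) : Prop where
  smooth : ∀ i j, ContDiffOn ℝ ∞ (fun w => S w i j) U
  inl_inr : ∀ w ∈ U, ∀ α β, S w (Sum.inl α) (Sum.inr β) = 0
  inr_inl : ∀ w ∈ U, ∀ α β, S w (Sum.inr α) (Sum.inl β) = 0

/-- `G` is smooth on `U`, respects the splitting, and its two blocks have positive determinants. -/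
structure IsSplitMetricOn (G : Model p q → Coeff p q) (U : Set (Model p q)) : Prop
    extends IsSplitOn G U where
  plus_re : ∀ w ∈ U, 0 < (G w).toBlocks₁₁.det.re
  plus_im : ∀ w ∈ U, (G w).toBlocks₁₁.det.im = 0
  minus_re : ∀ w ∈ U, 0 < (G w).toBlocks₂₂.det.re
  minus_im : ∀ w ∈ U, (G w).toBlocks₂₂.det.im = 0

namespace IsSplitMetricOn

theorem plus_ne (hG : IsSplitMetricOn G U) (hz : z ∈ U) : (G z).toBlocks₁₁.det ≠ 0 := fun h => by
  simpa [h] using hG.plus_re z hz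

theorem minus_ne (hG : IsSplitMetricOn G U) (hz : z ∈ U) : (G z).toBlocks₂₂.det ≠ 0 := fun h => by
  simpa [h] using hG.minus_re z hz

theorem eq_fromBlocks (hG : IsSplitMetricOn G U) (hz : z ∈ U) :
    G z = Matrix.fromBlocks (G z).toBlocks₁₁ 0 0 (G z).toBlocks₂₂ := by
  ext i j
  rcases i with i | i <;> rcases j with j | j
  · rfl
  · exact hG.inl_inr z hz i j
  · exact hG.inr_inl z hz i j
  · rfl

theorem isUnit_det (hG : IsSplitMetricOn G U) (hz : z ∈ U) : IsUnit (G z).det := by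
  rw [hG.eq_fromBlocks hz, Matrix.det_fromBlocks_zero₂₁]
  exact isUnit_iff_ne_zero.2 (mul_ne_zero (hG.plus_ne hz) (hG.minus_ne hz))

theorem inv_eq (hG : IsSplitMetricOn G U) (hz : z ∈ U) :
    (G z)⁻¹ = Matrix.fromBlocks (G z).toBlocks₁₁⁻¹ 0 0 (G z).toBlocks₂₂⁻¹ := by
  refine Matrix.inv_eq_right_inv ?_
  conv_lhs => rw [hG.eq_fromBlocks hz]
  rw [Matrix.fromBlocks_multiply]
  simp [Matrix.mul_nonsing_inv _ (isUnit_iff_ne_zero.2 (hG.plus_ne hz)),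
    Matrix.mul_nonsing_inv _ (isUnit_iff_ne_zero.2 (hG.minus_ne hz))]

theorem inv_inl_inl (hG : IsSplitMetricOn G U) (hz : z ∈ U) (a b : Fin p) :
    (G z)⁻¹ (Sum.inl a) (Sum.inl b) = (G z).toBlocks₁₁⁻¹ a b := by
  rw [hG.inv_eq hz, Matrix.fromBlocks_apply₁₁]

theorem inv_inr_inr (hG : IsSplitMetricOn G U) (hz : z ∈ U) (a b : Fin q) :
    (G z)⁻¹ (Sum.inr a) (Sum.inr b) = (G z).toBlocks₂₂⁻¹ a b := by
  rw [hG.inv_eq hz, Matrix.fromBlocks_apply₂₂]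

theorem inv_inl_inr (hG : IsSplitMetricOn G U) (hz : z ∈ U) (a : Fin p) (b : Fin q) :
    (G z)⁻¹ (Sum.inl a) (Sum.inr b) = 0 := by
  rw [hG.inv_eq hz, Matrix.fromBlocks_apply₁₂, Matrix.zero_apply]

theorem inv_inr_inl (hG : IsSplitMetricOn G U) (hz : z ∈ U) (a : Fin q) (b : Fin p) :
    (G z)⁻¹ (Sum.inr a) (Sum.inl b) = 0 := by
  rw [hG.inv_eq hz, Matrix.fromBlocks_apply₂₁, Matrix.zero_apply]

end IsSplitMetricOn

theorem IsSplitOn.wd_inl_inr (hS : IsSplitOn S U) (hU : IsOpen U) (hz : z ∈ U)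
    (i : Fin p ⊕ Fin q) (α : Fin p) (β : Fin q) :
    wd i (fun w => S w (Sum.inl α) (Sum.inr β)) z = 0 := by
  rw [wd_congr i hU hz fun w hw => hS.inl_inr w hw α β, wd_const]

theorem IsSplitOn.wd_inr_inl (hS : IsSplitOn S U) (hU : IsOpen U) (hz : z ∈ U)
    (i : Fin p ⊕ Fin q) (α : Fin q) (β : Fin p) :
    wd i (fun w => S w (Sum.inr α) (Sum.inl β)) z = 0 := by
  rw [wd_congr i hU hz fun w hw => hS.inr_inl w hw α β, wd_const]

/-- The other term of the torsion differentiates an off-diagonal entry, which vanishes identically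
near the point. -/
theorem IsSplitOn.torsion_inl_inr_inr (hS : IsSplitOn S U) (hU : IsOpen U) (hz : z ∈ U)
    (μ : Fin p) (α β : Fin q) :
    torsion S z (Sum.inl μ) (Sum.inr α) (Sum.inr β)
      = wd (Sum.inl μ) (fun w => S w (Sum.inr α) (Sum.inr β)) z := by
  rw [torsion, hS.wd_inl_inr hU hz, sub_zero]

theorem IsSplitOn.torsion_inr_inl_inl (hS : IsSplitOn S U) (hU : IsOpen U) (hz : z ∈ U)
    (ν : Fin q) (α β : Fin p) :
    torsion S z (Sum.inr ν) (Sum.inl α) (Sum.inl β)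
      = wd (Sum.inr ν) (fun w => S w (Sum.inl α) (Sum.inl β)) z := by
  rw [torsion, hS.wd_inr_inl hU hz, sub_zero]

/-- The Chern connection of a split metric preserves `T₊` and `T₋`, since the metric and its inverse
are block diagonal. -/
theorem chernConn_inl_inr (hG : IsSplitMetricOn G U) (hU : IsOpen U) (hz : z ∈ U)
    (i : Fin p ⊕ Fin q) (j : Fin p) (k : Fin q) :
    chernConn G z i (Sum.inl j) (Sum.inr k) = 0 := by
  simp [chernConn, Fintype.sum_sum_type, hG.inv_inl_inr hz, hG.wd_inl_inr hU hz]

theorem chernConn_inr_inl (hG : IsSplitMetricOn G U) (hU : IsOpen U) (hz : z ∈ U)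
    (i : Fin p ⊕ Fin q) (j : Fin q) (k : Fin p) :
    chernConn G z i (Sum.inr j) (Sum.inl k) = 0 := by
  simp [chernConn, Fintype.sum_sum_type, hG.inv_inr_inl hz, hG.wd_inr_inl hU hz]

theorem chernConn_inl_inl (hG : IsSplitMetricOn G U) (hz : z ∈ U)
    (i : Fin p ⊕ Fin q) (j k : Fin p) :
    chernConn G z i (Sum.inl j) (Sum.inl k)
      = ∑ l : Fin p, wd i (fun w => G w (Sum.inl j) (Sum.inl l)) z
          * (G z)⁻¹ (Sum.inl l) (Sum.inl k) := by
  simp [chernConn, Fintype.sum_sum_type, hG.inv_inr_inl hz]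

theorem chernConn_inr_inr (hG : IsSplitMetricOn G U) (hz : z ∈ U)
    (i : Fin p ⊕ Fin q) (j k : Fin q) :
    chernConn G z i (Sum.inr j) (Sum.inr k)
      = ∑ l : Fin q, wd i (fun w => G w (Sum.inr j) (Sum.inr l)) z
          * (G z)⁻¹ (Sum.inr l) (Sum.inr k) := by
  simp [chernConn, Fintype.sum_sum_type, hG.inv_inl_inr hz]

/-- Raising the last index of the torsion of a connection. -/
theorem sum_connTorsion_mul_inv {G : Coeff p q} (hG : IsUnit G.det) (A : ConnCoeff p q)
    (i j k : Fin p ⊕ Fin q) :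
    ∑ l, connTorsion G A i j l * G⁻¹ l k = A i j k - A j i k := by
  have h := congrFun (Matrix.vecMul_vecMul (fun m => A i j m - A j i m) G G⁻¹) k
  rw [Matrix.mul_nonsing_inv _ hG, Matrix.vecMul_one] at h
  simpa [Matrix.vecMul, dotProduct, connTorsion] using h

theorem sum_connTorsion_mul_inv_inl (hG : IsSplitMetricOn G U) (hz : z ∈ U) (A : ConnCoeff p q)
    (i j : Fin p ⊕ Fin q) (k : Fin p) :
    ∑ l : Fin p, connTorsion (G z) A i j (Sum.inl l) * (G z)⁻¹ (Sum.inl l) (Sum.inl k)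
      = A i j (Sum.inl k) - A j i (Sum.inl k) := by
  rw [← sum_connTorsion_mul_inv (hG.isUnit_det hz)]
  simp [Fintype.sum_sum_type, hG.inv_inr_inl hz]

theorem sum_connTorsion_mul_inv_inr (hG : IsSplitMetricOn G U) (hz : z ∈ U) (A : ConnCoeff p q)
    (i j : Fin p ⊕ Fin q) (k : Fin q) :
    ∑ l : Fin q, connTorsion (G z) A i j (Sum.inr l) * (G z)⁻¹ (Sum.inr l) (Sum.inr k)
      = A i j (Sum.inr k) - A j i (Sum.inr k) := by
  rw [← sum_connTorsion_mul_inv (hG.isUnit_det hz)]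
  simp [Fintype.sum_sum_type, hG.inv_inl_inr hz]

/-- The Hessian of `log det` produces `Γ_{μ α}` and the Laplacian `Γ_{α μ}`; this symmetry
reconciles them. -/
theorem chernConn_symm_inl (hG : IsSplitMetricOn G U) (hz : z ∈ U)
    (ht : ∀ a b c : Fin p, torsion G z (Sum.inl a) (Sum.inl b) (Sum.inl c) = 0) (a b c : Fin p) :
    chernConn G z (Sum.inl a) (Sum.inl b) (Sum.inl c)
      = chernConn G z (Sum.inl b) (Sum.inl a) (Sum.inl c) := by
  rw [← sub_eq_zero, ← sum_connTorsion_mul_inv_inl hG hz]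
  simp [connTorsion_chernConn G z (hG.isUnit_det hz), ht]

theorem chernConn_symm_inr (hG : IsSplitMetricOn G U) (hz : z ∈ U)
    (ht : ∀ a b c : Fin q, torsion G z (Sum.inr a) (Sum.inr b) (Sum.inr c) = 0) (a b c : Fin q) :
    chernConn G z (Sum.inr a) (Sum.inr b) (Sum.inr c)
      = chernConn G z (Sum.inr b) (Sum.inr a) (Sum.inr c) := by
  rw [← sub_eq_zero, ← sum_connTorsion_mul_inv_inr hG hz]
  simp [connTorsion_chernConn G z (hG.isUnit_det hz), ht]

/-- `g^{β̄₊ α₊} (∂_i ∂_j S_{α₊ β̄₊} - Γ_{i α₊}^{m₊} ∂_j S_{m₊ β̄₊})`. -/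
def traceHessPlus (G S : Model p q → Coeff p q) (i j : Fin p ⊕ Fin q) (z : Model p q) : ℂ :=
  ∑ α : Fin p, ∑ β : Fin p, (G z)⁻¹ (Sum.inl β) (Sum.inl α) *
    (wd i (wd j fun w => S w (Sum.inl α) (Sum.inl β)) z
      - ∑ m : Fin p, chernConn G z i (Sum.inl α) (Sum.inl m)
          * wd j (fun w => S w (Sum.inl m) (Sum.inl β)) z)

/-- `g^{β̄₋ α₋} (∂_i ∂_j S_{α₋ β̄₋} - Γ_{i α₋}^{m₋} ∂_j S_{m₋ β̄₋})`. -/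
def traceHessMinus (G S : Model p q → Coeff p q) (i j : Fin p ⊕ Fin q) (z : Model p q) : ℂ :=
  ∑ α : Fin q, ∑ β : Fin q, (G z)⁻¹ (Sum.inr β) (Sum.inr α) *
    (wd i (wd j fun w => S w (Sum.inr α) (Sum.inr β)) z
      - ∑ m : Fin q, chernConn G z i (Sum.inr α) (Sum.inr m)
          * wd j (fun w => S w (Sum.inr m) (Sum.inr β)) z)

/-- `g^{β̄₊ α₊} Γ_{α₊ ν₋}^{m₋} ∂_{m₋} S_{μ₊ β̄₊}`. -/
def crossPlus (G S : Model p q → Coeff p q) (μ : Fin p) (ν : Fin q) (z : Model p q) : ℂ :=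
  ∑ α : Fin p, ∑ β : Fin p, (G z)⁻¹ (Sum.inl β) (Sum.inl α) *
    ∑ m : Fin q, chernConn G z (Sum.inl α) (Sum.inr ν) (Sum.inr m)
      * wd (Sum.inr m) (fun w => S w (Sum.inl μ) (Sum.inl β)) z

/-- `g^{β̄₋ α₋} Γ_{α₋ μ₊}^{m₊} ∂_{m₊} S_{ν₋ β̄₋}`. -/
def crossMinus (G S : Model p q → Coeff p q) (μ : Fin p) (ν : Fin q) (z : Model p q) : ℂ :=
  ∑ α : Fin q, ∑ β : Fin q, (G z)⁻¹ (Sum.inr β) (Sum.inr α) *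
    ∑ m : Fin p, chernConn G z (Sum.inr α) (Sum.inl μ) (Sum.inl m)
      * wd (Sum.inl m) (fun w => S w (Sum.inr ν) (Sum.inr β)) z

/-- Written out, both are the contraction of `∂_{α₊} g_{ν₋ l̄₋}` with `∂_{m₋} g_{μ₊ β̄₊}` by the
inverses of both blocks, so they differ only in the names of the indices. This is why no term
quadratic in the connection of `g` survives in `Ψ`. -/
theorem crossPlus_self (hG : IsSplitMetricOn G U) (hz : z ∈ U) (μ : Fin p) (ν : Fin q) :
    crossPlus G G μ ν z = crossMinus G G μ ν z := by
  simp only [crossPlus, crossMinus, chernConn_inl_inl hG hz, chernConn_inr_inr hG hz,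
    Finset.mul_sum, Finset.sum_mul]
  have e : ∀ F : Fin p → Fin p → Fin q → Fin q → ℂ,
      ∑ a, ∑ b, ∑ m, ∑ l, F a b m l = ∑ m, ∑ l, ∑ a, ∑ b, F a b m l := by
    intro F
    calc ∑ a, ∑ b, ∑ m, ∑ l, F a b m l
        = ∑ x : Fin p × Fin p, ∑ y : Fin q × Fin q, F x.1 x.2 y.1 y.2 := by
          simp only [Fintype.sum_prod_type]
      _ = ∑ y : Fin q × Fin q, ∑ x : Fin p × Fin p, F x.1 x.2 y.1 y.2 := Finset.sum_comm
      _ = _ := by simp only [Fintype.sum_prod_type]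
  rw [e]
  refine Finset.sum_congr rfl fun a _ => Finset.sum_congr rfl fun b _ =>
    Finset.sum_congr rfl fun c _ => Finset.sum_congr rfl fun d _ => ?_
  ring

theorem wd_wd_logDetPlus (hG : IsSplitMetricOn G U) (hU : IsOpen U) (hz : z ∈ U)
    (i j : Fin p ⊕ Fin q) : wd i (wd j (logDetPlus G)) z = traceHessPlus G G i j z := by
  simp only [traceHessPlus, hG.inv_inl_inl hz, chernConn_inl_inl hG hz]
  exact wd_wd_log_det (A := fun w => (G w).toBlocks₁₁) i j hU hz
    (fun a b => hG.smooth (Sum.inl a) (Sum.inl b)) hG.plus_re hG.plus_im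

theorem wd_wd_logDetMinus (hG : IsSplitMetricOn G U) (hU : IsOpen U) (hz : z ∈ U)
    (i j : Fin p ⊕ Fin q) : wd i (wd j (logDetMinus G)) z = traceHessMinus G G i j z := by
  simp only [traceHessMinus, hG.inv_inr_inr hz, chernConn_inr_inr hG hz]
  exact wd_wd_log_det (A := fun w => (G w).toBlocks₂₂) i j hU hz
    (fun a b => hG.smooth (Sum.inr a) (Sum.inr b)) hG.minus_re hG.minus_im

theorem logDetPlus_contDiffOn (hG : IsSplitMetricOn G U) : ContDiffOn ℝ ∞ (logDetPlus G) U :=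
  log_det_contDiffOn (A := fun w => (G w).toBlocks₁₁)
    (fun a b => hG.smooth (Sum.inl a) (Sum.inl b)) hG.plus_re

theorem logDetMinus_contDiffOn (hG : IsSplitMetricOn G U) : ContDiffOn ℝ ∞ (logDetMinus G) U :=
  log_det_contDiffOn (A := fun w => (G w).toBlocks₂₂)
    (fun a b => hG.smooth (Sum.inr a) (Sum.inr b)) hG.minus_re

theorem covTorsion_inr_inl_inr_inr (hS : IsSplitOn S U) (hU : IsOpen U) (hz : z ∈ U)
    (hG : IsSplitMetricOn G U) (μ : Fin p) (ν α β : Fin q) :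
    covTorsion (chernConn G z) S z (Sum.inr ν) (Sum.inl μ) (Sum.inr α) (Sum.inr β)
      = wd (Sum.inr ν) (wd (Sum.inl μ) fun w => S w (Sum.inr α) (Sum.inr β)) z
        - ∑ m : Fin p, chernConn G z (Sum.inr ν) (Sum.inl μ) (Sum.inl m)
            * wd (Sum.inl m) (fun w => S w (Sum.inr α) (Sum.inr β)) z
        - ∑ m : Fin q, chernConn G z (Sum.inr ν) (Sum.inr α) (Sum.inr m)
            * wd (Sum.inl μ) (fun w => S w (Sum.inr m) (Sum.inr β)) z := by
  rw [covTorsion, wd_congr _ hU hz fun w hw => hS.torsion_inl_inr_inr hU hw μ α β]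
  simp [Fintype.sum_sum_type, chernConn_inl_inr hG hU hz, chernConn_inr_inl hG hU hz,
    hS.torsion_inl_inr_inr hU hz]

theorem covTorsion_inl_inr_inl_inl (hS : IsSplitOn S U) (hU : IsOpen U) (hz : z ∈ U)
    (hG : IsSplitMetricOn G U) (ν : Fin q) (μ α β : Fin p) :
    covTorsion (chernConn G z) S z (Sum.inl μ) (Sum.inr ν) (Sum.inl α) (Sum.inl β)
      = wd (Sum.inl μ) (wd (Sum.inr ν) fun w => S w (Sum.inl α) (Sum.inl β)) z
        - ∑ m : Fin q, chernConn G z (Sum.inl μ) (Sum.inr ν) (Sum.inr m)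
            * wd (Sum.inr m) (fun w => S w (Sum.inl α) (Sum.inl β)) z
        - ∑ m : Fin p, chernConn G z (Sum.inl μ) (Sum.inl α) (Sum.inl m)
            * wd (Sum.inr ν) (fun w => S w (Sum.inl m) (Sum.inl β)) z := by
  rw [covTorsion, wd_congr _ hU hz fun w hw => hS.torsion_inr_inl_inl hU hw ν α β]
  simp [Fintype.sum_sum_type, chernConn_inl_inr hG hU hz, chernConn_inr_inl hG hU hz,
    hS.torsion_inr_inl_inl hU hz]

/-- Summing out the barred index of a product of four factors against a lowered torsion. -/
theorem sum_mul_contract {m n : ℕ} (x : Fin m → Fin m → ℂ) (y : Fin n → Fin n → ℂ)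
    (T : Fin m → Fin n → ℂ) (R : Fin n → Fin m → Fin m → ℂ) :
    ∑ α, ∑ β, ∑ γ, ∑ σ, x β α * y σ γ * T α σ * R γ α β
      = ∑ α, ∑ β, x β α * ∑ γ, (∑ σ, T α σ * y σ γ) * R γ α β := by
  simp only [Finset.mul_sum, Finset.sum_mul]
  refine Finset.sum_congr rfl fun a _ => Finset.sum_congr rfl fun b _ =>
    Finset.sum_congr rfl fun c _ => Finset.sum_congr rfl fun d _ => ?_
  ring

/-- The term of `∇T` that the Hessian of `log det` lacks is `-Γ_{ν₋ μ₊}^{m₊} ∂_{m₊} S_{α₋ β̄₋}`.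
Raising the index of `T_{μ₊ ν₋ σ̄₊}` gives `-Γ_{ν₋ μ₊}^{γ₊}`, because `Γ_{μ₊ ν₋}^{γ₊} = 0`, so
subtracting the product of torsions removes exactly that term. -/
theorem trace_covTorsion_minus (hS : IsSplitOn S U) (hU : IsOpen U) (hz : z ∈ U)
    (hG : IsSplitMetricOn G U) (μ : Fin p) (ν : Fin q) :
    (∑ α : Fin q, ∑ β : Fin q, (G z)⁻¹ (Sum.inr β) (Sum.inr α) *
      covTorsion (chernConn G z) S z (Sum.inr ν) (Sum.inl μ) (Sum.inr α) (Sum.inr β))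
    - (∑ α : Fin q, ∑ β : Fin q, ∑ γ : Fin p, ∑ σ : Fin p,
      (G z)⁻¹ (Sum.inr β) (Sum.inr α) * (G z)⁻¹ (Sum.inl σ) (Sum.inl γ) *
      connTorsion (G z) (chernConn G z) (Sum.inl μ) (Sum.inr ν) (Sum.inl σ) *
      torsion S z (Sum.inl γ) (Sum.inr α) (Sum.inr β))
    = traceHessMinus G S (Sum.inr ν) (Sum.inl μ) z := by
  rw [sum_mul_contract (fun β α => (G z)⁻¹ (Sum.inr β) (Sum.inr α))
    (fun σ γ => (G z)⁻¹ (Sum.inl σ) (Sum.inl γ))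
    (fun _ σ => connTorsion (G z) (chernConn G z) (Sum.inl μ) (Sum.inr ν) (Sum.inl σ))
    (fun γ α β => torsion S z (Sum.inl γ) (Sum.inr α) (Sum.inr β))]
  simp only [sum_connTorsion_mul_inv_inl hG hz, covTorsion_inr_inl_inr_inr hS hU hz hG,
    chernConn_inr_inl hG hU hz, hS.torsion_inl_inr_inr hU hz, traceHessMinus,
    ← Finset.sum_sub_distrib]
  refine Finset.sum_congr rfl fun a _ => Finset.sum_congr rfl fun b _ => ?_
  simp only [zero_sub, neg_mul, Finset.sum_neg_distrib]
  ring

/-- The same cancellation with the opposite sign: here the raised torsion is `+Γ_{μ₊ ν₋}^{γ₋}`,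
because `Γ_{ν₋ μ₊}^{γ₋} = 0`. -/
theorem trace_covTorsion_plus (hS : IsSplitOn S U) (hU : IsOpen U) (hz : z ∈ U)
    (hG : IsSplitMetricOn G U) (μ : Fin p) (ν : Fin q) :
    (∑ α : Fin p, ∑ β : Fin p, (G z)⁻¹ (Sum.inl β) (Sum.inl α) *
      covTorsion (chernConn G z) S z (Sum.inl μ) (Sum.inr ν) (Sum.inl α) (Sum.inl β))
    + (∑ α : Fin p, ∑ β : Fin p, ∑ γ : Fin q, ∑ σ : Fin q,
      (G z)⁻¹ (Sum.inl β) (Sum.inl α) * (G z)⁻¹ (Sum.inr σ) (Sum.inr γ) *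
      connTorsion (G z) (chernConn G z) (Sum.inl μ) (Sum.inr ν) (Sum.inr σ) *
      torsion S z (Sum.inr γ) (Sum.inl α) (Sum.inl β))
    = traceHessPlus G S (Sum.inl μ) (Sum.inr ν) z := by
  rw [sum_mul_contract (fun β α => (G z)⁻¹ (Sum.inl β) (Sum.inl α))
    (fun σ γ => (G z)⁻¹ (Sum.inr σ) (Sum.inr γ))
    (fun _ σ => connTorsion (G z) (chernConn G z) (Sum.inl μ) (Sum.inr ν) (Sum.inr σ))
    (fun γ α β => torsion S z (Sum.inr γ) (Sum.inl α) (Sum.inl β))]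
  simp only [sum_connTorsion_mul_inv_inr hG hz, covTorsion_inl_inr_inl_inl hS hU hz hG,
    chernConn_inl_inr hG hU hz, hS.torsion_inr_inl_inl hU hz, traceHessPlus,
    ← Finset.sum_add_distrib]
  refine Finset.sum_congr rfl fun a _ => Finset.sum_congr rfl fun b _ => ?_
  simp only [sub_zero]
  ring

theorem crossMinus_eq (hS : IsSplitOn S U) (hU : IsOpen U) (hz : z ∈ U)
    (hG : IsSplitMetricOn G U) (μ : Fin p) (ν : Fin q) :
    (∑ α : Fin q, ∑ β : Fin q, ∑ γ : Fin p, ∑ δ : Fin p,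
      (G z)⁻¹ (Sum.inr β) (Sum.inr α) * (G z)⁻¹ (Sum.inl γ) (Sum.inl δ) *
      connTorsion (G z) (chernConn G z) (Sum.inr α) (Sum.inl μ) (Sum.inl γ) *
      torsion S z (Sum.inl δ) (Sum.inr ν) (Sum.inr β)) = crossMinus G S μ ν z := by
  -- The barred index `γ` must be summed innermost for `sum_mul_contract` to raise it.
  have h : ∀ α β : Fin q, ∑ γ : Fin p, ∑ δ : Fin p,
      (G z)⁻¹ (Sum.inr β) (Sum.inr α) * (G z)⁻¹ (Sum.inl γ) (Sum.inl δ) *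
      connTorsion (G z) (chernConn G z) (Sum.inr α) (Sum.inl μ) (Sum.inl γ) *
      torsion S z (Sum.inl δ) (Sum.inr ν) (Sum.inr β)
      = ∑ δ : Fin p, ∑ γ : Fin p,
      (G z)⁻¹ (Sum.inr β) (Sum.inr α) * (G z)⁻¹ (Sum.inl γ) (Sum.inl δ) *
      connTorsion (G z) (chernConn G z) (Sum.inr α) (Sum.inl μ) (Sum.inl γ) *
      torsion S z (Sum.inl δ) (Sum.inr ν) (Sum.inr β) := fun _ _ => Finset.sum_comm
  simp only [h]
  rw [sum_mul_contract (fun β α => (G z)⁻¹ (Sum.inr β) (Sum.inr α))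
    (fun σ γ => (G z)⁻¹ (Sum.inl σ) (Sum.inl γ))
    (fun α σ => connTorsion (G z) (chernConn G z) (Sum.inr α) (Sum.inl μ) (Sum.inl σ))
    (fun γ _ β => torsion S z (Sum.inl γ) (Sum.inr ν) (Sum.inr β))]
  simp only [sum_connTorsion_mul_inv_inl hG hz, chernConn_inr_inl hG hU hz, sub_zero,
    hS.torsion_inl_inr_inr hU hz, crossMinus]

theorem crossPlus_eq (hS : IsSplitOn S U) (hU : IsOpen U) (hz : z ∈ U)
    (hG : IsSplitMetricOn G U) (μ : Fin p) (ν : Fin q) :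
    (∑ α : Fin p, ∑ β : Fin p, ∑ γ : Fin q, ∑ δ : Fin q,
      (G z)⁻¹ (Sum.inl β) (Sum.inl α) * (G z)⁻¹ (Sum.inr γ) (Sum.inr δ) *
      connTorsion (G z) (chernConn G z) (Sum.inl α) (Sum.inr ν) (Sum.inr γ) *
      torsion S z (Sum.inr δ) (Sum.inl μ) (Sum.inl β)) = crossPlus G S μ ν z := by
  have h : ∀ α β : Fin p, ∑ γ : Fin q, ∑ δ : Fin q,
      (G z)⁻¹ (Sum.inl β) (Sum.inl α) * (G z)⁻¹ (Sum.inr γ) (Sum.inr δ) *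
      connTorsion (G z) (chernConn G z) (Sum.inl α) (Sum.inr ν) (Sum.inr γ) *
      torsion S z (Sum.inr δ) (Sum.inl μ) (Sum.inl β)
      = ∑ δ : Fin q, ∑ γ : Fin q,
      (G z)⁻¹ (Sum.inl β) (Sum.inl α) * (G z)⁻¹ (Sum.inr γ) (Sum.inr δ) *
      connTorsion (G z) (chernConn G z) (Sum.inl α) (Sum.inr ν) (Sum.inr γ) *
      torsion S z (Sum.inr δ) (Sum.inl μ) (Sum.inl β) := fun _ _ => Finset.sum_comm
  simp only [h]
  rw [sum_mul_contract (fun β α => (G z)⁻¹ (Sum.inl β) (Sum.inl α))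
    (fun σ γ => (G z)⁻¹ (Sum.inr σ) (Sum.inr γ))
    (fun α σ => connTorsion (G z) (chernConn G z) (Sum.inl α) (Sum.inr ν) (Sum.inr σ))
    (fun γ _ β => torsion S z (Sum.inr γ) (Sum.inl μ) (Sum.inl β))]
  simp only [sum_connTorsion_mul_inv_inr hG hz, chernConn_inl_inr hG hU hz, sub_zero,
    hS.torsion_inr_inl_inl hU hz, crossPlus]

/-- `Ψ` in terms of the Hessians of the backgrounds. -/
theorem Psi_eq {H : Model p q → Coeff p q} (hU : IsOpen U) (hz : z ∈ U)
    (hH : IsSplitMetricOn H U) (hS : IsSplitOn S U) (hG : IsSplitMetricOn G U)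
    (μ : Fin p) (ν : Fin q) :
    Psi H S z (G z) (chernConn G z) μ ν
      = traceHessMinus H H (Sum.inr ν) (Sum.inl μ) z - traceHessPlus H H (Sum.inl μ) (Sum.inr ν) z
        - traceHessMinus G S (Sum.inr ν) (Sum.inl μ) z
        + traceHessPlus G S (Sum.inl μ) (Sum.inr ν) z
        + crossMinus G S μ ν z - crossPlus G S μ ν z := by
  -- In the terms in `h` the torsion is given by derivatives, in the terms in `g` by connection
  -- coefficients; identifying the two lets one pair of trace identities serve both.
  have hT := connTorsion_chernConn H z (hH.isUnit_det hz)
  rw [← trace_covTorsion_minus hH.toIsSplitOn hU hz hH, ← trace_covTorsion_plus hH.toIsSplitOn hU hz hH,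
    ← trace_covTorsion_minus hS hU hz hG, ← trace_covTorsion_plus hS hU hz hG,
    ← crossMinus_eq hS hU hz hG, ← crossPlus_eq hS hU hz hG]
  simp only [hT, Psi]
  ring

end SplitMetrics

/-! ### The spatial evolution identity. -/

section Evolution

variable {p q : ℕ} {U : Set (Model p q)} {z : Model p q} {S G H : Model p q → Coeff p q}
  {u : Model p q → ℂ}

theorem boxForm_smooth (hU : IsOpen U) (hu : ContDiffOn ℝ ∞ u U) (i j : Fin p ⊕ Fin q) :
    ContDiffOn ℝ ∞ (fun w => boxForm u w i j) U := by
  rcases i with i | i <;> rcases j with j | j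
  · exact wd_contDiffOn _ hU (wdbar_contDiffOn _ hU hu)
  · exact contDiffOn_const
  · exact contDiffOn_const
  · exact (wd_contDiffOn _ hU (wdbar_contDiffOn _ hU hu)).neg

theorem isSplitOn_boxForm (hU : IsOpen U) (hu : ContDiffOn ℝ ∞ u U) : IsSplitOn (boxForm u) U :=
  ⟨boxForm_smooth hU hu, fun _ _ _ _ => rfl, fun _ _ _ _ => rfl⟩

/-- On a pure block `boxForm` is `±∂∂̄u`, and its torsion is a commutator of two holomorphic
derivatives of `∂̄u`. -/
theorem torsion_boxForm_inl (hU : IsOpen U) (hz : z ∈ U) (hu : ContDiffOn ℝ ∞ u U)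
    (a b c : Fin p) : torsion (boxForm u) z (Sum.inl a) (Sum.inl b) (Sum.inl c) = 0 :=
  sub_eq_zero.2 (wd_comm _ _ hU hz (wdbar_contDiffOn _ hU hu))

theorem torsion_boxForm_inr (hU : IsOpen U) (hz : z ∈ U) (hu : ContDiffOn ℝ ∞ u U)
    (a b c : Fin q) : torsion (boxForm u) z (Sum.inr a) (Sum.inr b) (Sum.inr c) = 0 := by
  have h := wd_comm (Sum.inr a) (Sum.inr b) hU hz (wdbar_contDiffOn (Sum.inr c) hU hu)
  simp only [torsion, boxForm, wd_neg]
  exact sub_eq_zero.2 (congrArg Neg.neg h)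

theorem torsion_add {B C : Model p q → Coeff p q}
    (hB : ∀ i j, DifferentiableAt ℝ (fun w => B w i j) z)
    (hC : ∀ i j, DifferentiableAt ℝ (fun w => C w i j) z) (i j k : Fin p ⊕ Fin q) :
    torsion (fun w => B w + C w) z i j k = torsion B z i j k + torsion C z i j k := by
  simp only [torsion, Matrix.add_apply, wd_add _ (hB _ _) (hC _ _)]
  ring

/-- Linearity holds with the contracting metric `G` and its connection held fixed; it separates the
potential from the background. -/
theorem traceHessPlus_sub (hU : IsOpen U) (hz : z ∈ U) {B C : Model p q → Coeff p q}
    (hB : IsSplitOn B U) (hC : IsSplitOn C U) (i j : Fin p ⊕ Fin q) :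
    traceHessPlus G (fun w => B w - C w) i j z = traceHessPlus G B i j z - traceHessPlus G C i j z := by
  have d : ∀ {D : Model p q → Coeff p q}, IsSplitOn D U → ∀ i j, ∀ w ∈ U,
      DifferentiableAt ℝ (fun w => D w i j) w := fun hD i j w hw =>
    differentiableAt_of_contDiffOn hU (hD.smooth i j) hw
  have d2 : ∀ {D : Model p q → Coeff p q}, IsSplitOn D U → ∀ i j k,
      DifferentiableAt ℝ (wd k (fun w => D w i j)) z := fun hD i j k =>
    differentiableAt_of_contDiffOn hU (wd_contDiffOn k hU (hD.smooth i j)) hz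
  have h1 : ∀ k l m, ∀ w ∈ U, wd m (fun w => (B w - C w) k l) w
      = wd m (fun w => B w k l) w - wd m (fun w => C w k l) w := fun k l m w hw =>
    wd_sub m (d hB k l w hw) (d hC k l w hw)
  have h2 : ∀ k l, wd i (wd j fun w => (B w - C w) k l) z
      = wd i (wd j fun w => B w k l) z - wd i (wd j fun w => C w k l) z := fun k l => by
    rw [wd_congr i hU hz (h1 k l j), wd_sub i (d2 hB k l j) (d2 hC k l j)]
  simp only [traceHessPlus, h1 _ _ _ z hz, h2, ← Finset.sum_sub_distrib, mul_sub]
  refine Finset.sum_congr rfl fun a _ => Finset.sum_congr rfl fun b _ => ?_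
  simp only [Finset.sum_sub_distrib]
  ring

theorem traceHessMinus_sub (hU : IsOpen U) (hz : z ∈ U) {B C : Model p q → Coeff p q}
    (hB : IsSplitOn B U) (hC : IsSplitOn C U) (i j : Fin p ⊕ Fin q) :
    traceHessMinus G (fun w => B w - C w) i j z
      = traceHessMinus G B i j z - traceHessMinus G C i j z := by
  have d : ∀ {D : Model p q → Coeff p q}, IsSplitOn D U → ∀ i j, ∀ w ∈ U,
      DifferentiableAt ℝ (fun w => D w i j) w := fun hD i j w hw =>
    differentiableAt_of_contDiffOn hU (hD.smooth i j) hw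
  have d2 : ∀ {D : Model p q → Coeff p q}, IsSplitOn D U → ∀ i j k,
      DifferentiableAt ℝ (wd k (fun w => D w i j)) z := fun hD i j k =>
    differentiableAt_of_contDiffOn hU (wd_contDiffOn k hU (hD.smooth i j)) hz
  have h1 : ∀ k l m, ∀ w ∈ U, wd m (fun w => (B w - C w) k l) w
      = wd m (fun w => B w k l) w - wd m (fun w => C w k l) w := fun k l m w hw =>
    wd_sub m (d hB k l w hw) (d hC k l w hw)
  have h2 : ∀ k l, wd i (wd j fun w => (B w - C w) k l) z
      = wd i (wd j fun w => B w k l) z - wd i (wd j fun w => C w k l) z := fun k l => by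
    rw [wd_congr i hU hz (h1 k l j), wd_sub i (d2 hB k l j) (d2 hC k l j)]
  simp only [traceHessMinus, h1 _ _ _ z hz, h2, ← Finset.sum_sub_distrib, mul_sub]
  refine Finset.sum_congr rfl fun a _ => Finset.sum_congr rfl fun b _ => ?_
  simp only [Finset.sum_sub_distrib]
  ring

theorem crossPlus_sub (hU : IsOpen U) (hz : z ∈ U) {B C : Model p q → Coeff p q}
    (hB : IsSplitOn B U) (hC : IsSplitOn C U) (μ : Fin p) (ν : Fin q) :
    crossPlus G (fun w => B w - C w) μ ν z = crossPlus G B μ ν z - crossPlus G C μ ν z := by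
  simp only [crossPlus, Matrix.sub_apply, ← Finset.sum_sub_distrib, ← mul_sub,
    wd_sub _ (differentiableAt_of_contDiffOn hU (hB.smooth _ _) hz)
      (differentiableAt_of_contDiffOn hU (hC.smooth _ _) hz)]

theorem crossMinus_sub (hU : IsOpen U) (hz : z ∈ U) {B C : Model p q → Coeff p q}
    (hB : IsSplitOn B U) (hC : IsSplitOn C U) (μ : Fin p) (ν : Fin q) :
    crossMinus G (fun w => B w - C w) μ ν z = crossMinus G B μ ν z - crossMinus G C μ ν z := by
  simp only [crossMinus, Matrix.sub_apply, ← Finset.sum_sub_distrib, ← mul_sub,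
    wd_sub _ (differentiableAt_of_contDiffOn hU (hB.smooth _ _) hz)
      (differentiableAt_of_contDiffOn hU (hC.smooth _ _) hz)]

/-- The Laplacian of an antisymmetric tensor of mixed type. -/
theorem chernLaplacian_mixedForm (hU : IsOpen U) (hz : z ∈ U) (hG : IsSplitMetricOn G U)
    (c : Model p q → Fin p → Fin q → ℂ) (i j : Fin p ⊕ Fin q) :
    chernLaplacian G (fun w => mixedForm (c w)) z i j
      = mixedForm (fun μ ν => ∑ a, ∑ b, (G z)⁻¹ b a *
          (wd a (wdbar b fun w => c w μ ν) z
            - ∑ m : Fin p, chernConn G z a (Sum.inl μ) (Sum.inl m) * wdbar b (fun w => c w m ν) z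
            - ∑ m : Fin q, chernConn G z a (Sum.inr ν) (Sum.inr m) * wdbar b (fun w => c w μ m) z))
        i j := by
  have hc : ∀ b : Fin p ⊕ Fin q, wdbar b (fun _ : Model p q => (0 : ℂ)) = fun _ => 0 := fun b =>
    funext fun w => wdbar_const b 0
  have hn : ∀ (b : Fin p ⊕ Fin q) (v : Model p q → ℂ),
      wdbar b (fun w => -v w) = fun w => -wdbar b v w := fun b v => funext fun w => wdbar_neg b
  rcases i with i | i <;> rcases j with j | j
  · simp [chernLaplacian, mixedForm, Fintype.sum_sum_type, chernConn_inl_inr hG hU hz, hc, wd_const]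
  · simp [chernLaplacian, mixedForm, Fintype.sum_sum_type, chernConn_inl_inr hG hU hz,
      chernConn_inr_inl hG hU hz]
  · simp only [chernLaplacian, mixedForm, Fintype.sum_sum_type, chernConn_inl_inr hG hU hz,
      chernConn_inr_inl hG hU hz, hn, wd_neg, zero_mul, Finset.sum_const_zero, add_zero, zero_add,
      mul_neg]
    simp only [← Finset.sum_neg_distrib, neg_add]
    congr 1 <;> refine Finset.sum_congr rfl fun a _ => ?_ <;> congr 1 <;>
      refine Finset.sum_congr rfl fun b _ => ?_ <;>
      simp only [Finset.sum_neg_distrib] <;> ring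
  · simp [chernLaplacian, mixedForm, Fintype.sum_sum_type, chernConn_inr_inl hG hU hz, hc, wd_const]

/-- Commuting derivatives turns every term of the Laplacian into a derivative of `boxForm u`. The
trace over `T₊` is a Hessian trace once `Γ` is symmetrized, minus the cross term in which `Γ` acts
on the `T₋` index. The trace over `T₋` is analogous, with both signs reversed since `boxForm` is
`-∂∂̄u` there. -/
theorem chernLaplacian_torsionPotential (hU : IsOpen U) (hz : z ∈ U) (hG : IsSplitMetricOn G U)
    (hu : ContDiffOn ℝ ∞ u U)
    (hp : ∀ a b c : Fin p, torsion G z (Sum.inl a) (Sum.inl b) (Sum.inl c) = 0)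
    (hm : ∀ a b c : Fin q, torsion G z (Sum.inr a) (Sum.inr b) (Sum.inr c) = 0)
    (i j : Fin p ⊕ Fin q) :
    chernLaplacian G (torsionPotential u) z i j
      = mixedForm (fun μ ν =>
          traceHessPlus G (boxForm u) (Sum.inl μ) (Sum.inr ν) z
          - traceHessMinus G (boxForm u) (Sum.inr ν) (Sum.inl μ) z
          - crossPlus G (boxForm u) μ ν z + crossMinus G (boxForm u) μ ν z) i j := by
  have hw1 : ∀ k, ContDiffOn ℝ ∞ (wd k u) U := fun k => wd_contDiffOn k hU hu
  have hb1 : ∀ k, ContDiffOn ℝ ∞ (wdbar k u) U := fun k => wdbar_contDiffOn k hU hu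
  have hbw : ∀ b k l, ∀ w ∈ U, wdbar b (wd k (wd l u)) w = wd k (wd l (wdbar b u)) w := by
    intro b k l w hw
    rw [← wd_wdbar_comm k b hU hw (hw1 l)]
    exact wd_congr k hU hw fun x hx => (wd_wdbar_comm l b hU hx hu).symm
  have h4 : ∀ a b k l, wd a (wdbar b (wd k (wd l u))) z = wd k (wd l (wd a (wdbar b u))) z := by
    intro a b k l
    rw [wd_congr a hU hz (hbw b k l), wd_comm a k hU hz (wd_contDiffOn l hU (hb1 b))]
    exact wd_congr k hU hz fun x hx => wd_comm a l hU hx (hb1 b)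
  have hneg : ∀ (k : Fin p ⊕ Fin q) (v : Model p q → ℂ),
      wd k (fun w => -v w) = fun w => -wd k v w := fun k v => funext fun w => wd_neg k
  have key := chernLaplacian_mixedForm hU hz hG
    (fun w μ ν => wd (Sum.inr ν) (wd (Sum.inl μ) u) w) i j
  refine key.trans ?_
  congr 1
  funext μ ν
  simp only [Fintype.sum_sum_type, hG.inv_inl_inr hz, hG.inv_inr_inl hz, zero_mul,
    Finset.sum_const_zero, add_zero, zero_add]
  have e1 : ∀ a b : Fin p,
      (wd (Sum.inl a) (wdbar (Sum.inl b) fun w => wd (Sum.inr ν) (wd (Sum.inl μ) u) w) z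
        = wd (Sum.inl μ) (wd (Sum.inr ν) fun w => boxForm u w (Sum.inl a) (Sum.inl b)) z) := by
    intro a b
    refine (h4 _ _ _ _).trans ?_
    exact wd_comm _ _ hU hz (wd_contDiffOn _ hU (hb1 _))
  have e2 : ∀ a b : Fin q,
      (wd (Sum.inr a) (wdbar (Sum.inr b) fun w => wd (Sum.inr ν) (wd (Sum.inl μ) u) w) z
        = -wd (Sum.inr ν) (wd (Sum.inl μ) fun w => boxForm u w (Sum.inr a) (Sum.inr b)) z) := by
    intro a b
    refine (h4 _ _ _ _).trans ?_
    simp only [boxForm, hneg, neg_neg]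
  have e3 : ∀ b m : Fin p, wdbar (Sum.inl b) (fun w => wd (Sum.inr ν) (wd (Sum.inl m) u) w) z
      = wd (Sum.inr ν) (fun w => boxForm u w (Sum.inl m) (Sum.inl b)) z := fun b m =>
    hbw _ _ _ z hz
  have e4 : ∀ (b : Fin p) (m : Fin q),
      wdbar (Sum.inl b) (fun w => wd (Sum.inr m) (wd (Sum.inl μ) u) w) z
      = wd (Sum.inr m) (fun w => boxForm u w (Sum.inl μ) (Sum.inl b)) z := fun b m =>
    hbw _ _ _ z hz
  have e5 : ∀ (b : Fin q) (m : Fin p),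
      wdbar (Sum.inr b) (fun w => wd (Sum.inr ν) (wd (Sum.inl m) u) w) z
      = -wd (Sum.inl m) (fun w => boxForm u w (Sum.inr ν) (Sum.inr b)) z := by
    intro b m
    refine (hbw _ _ _ z hz).trans ?_
    simp only [boxForm, hneg, neg_neg]
    exact wd_comm _ _ hU hz (hb1 _)
  have e6 : ∀ (b : Fin q) (m : Fin q),
      wdbar (Sum.inr b) (fun w => wd (Sum.inr m) (wd (Sum.inl μ) u) w) z
      = -wd (Sum.inl μ) (fun w => boxForm u w (Sum.inr m) (Sum.inr b)) z := by
    intro b m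
    refine (hbw _ _ _ z hz).trans ?_
    simp only [boxForm, hneg, neg_neg]
    exact wd_comm _ _ hU hz (hb1 _)
  simp only [e1, e2, e3, e4, e5, e6]
  have f1 : (∑ a : Fin p, ∑ b : Fin p, (G z)⁻¹ (Sum.inl b) (Sum.inl a) *
      (wd (Sum.inl μ) (wd (Sum.inr ν) fun w => boxForm u w (Sum.inl a) (Sum.inl b)) z
        - ∑ m : Fin p, chernConn G z (Sum.inl a) (Sum.inl μ) (Sum.inl m) *
            wd (Sum.inr ν) (fun w => boxForm u w (Sum.inl m) (Sum.inl b)) z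
        - ∑ m : Fin q, chernConn G z (Sum.inl a) (Sum.inr ν) (Sum.inr m) *
            wd (Sum.inr m) (fun w => boxForm u w (Sum.inl μ) (Sum.inl b)) z))
      = traceHessPlus G (boxForm u) (Sum.inl μ) (Sum.inr ν) z
          - crossPlus G (boxForm u) μ ν z := by
    simp only [traceHessPlus, crossPlus, ← Finset.sum_sub_distrib, ← mul_sub,
      chernConn_symm_inl hG hz hp _ μ]
  have f2 : (∑ a : Fin q, ∑ b : Fin q, (G z)⁻¹ (Sum.inr b) (Sum.inr a) *
      (-wd (Sum.inr ν) (wd (Sum.inl μ) fun w => boxForm u w (Sum.inr a) (Sum.inr b)) z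
        - ∑ m : Fin p, chernConn G z (Sum.inr a) (Sum.inl μ) (Sum.inl m) *
            -wd (Sum.inl m) (fun w => boxForm u w (Sum.inr ν) (Sum.inr b)) z
        - ∑ m : Fin q, chernConn G z (Sum.inr a) (Sum.inr ν) (Sum.inr m) *
            -wd (Sum.inl μ) (fun w => boxForm u w (Sum.inr m) (Sum.inr b)) z))
      = crossMinus G (boxForm u) μ ν z
        - traceHessMinus G (boxForm u) (Sum.inr ν) (Sum.inl μ) z := by
    simp only [traceHessMinus, crossMinus, ← Finset.sum_sub_distrib, ← mul_sub,
      chernConn_symm_inr hG hz hm _ ν, mul_neg, Finset.sum_neg_distrib]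
    refine Finset.sum_congr rfl fun a _ => Finset.sum_congr rfl fun b _ => ?_
    ring
  rw [f1, f2]
  ring

/-- The spatial part of the evolution equation of the torsion potential. -/
theorem wd_wd_log_det_ratio (hU : IsOpen U) (hz : z ∈ U) (hH : IsSplitMetricOn H U)
    (hS : IsSplitOn S U) (hG : IsSplitMetricOn G U) (hu : ContDiffOn ℝ ∞ u U)
    (hGS : ∀ w ∈ U, G w = S w + boxForm u w)
    (hp : ∀ a b c : Fin p, torsion S z (Sum.inl a) (Sum.inl b) (Sum.inl c) = 0)
    (hm : ∀ a b c : Fin q, torsion S z (Sum.inr a) (Sum.inr b) (Sum.inr c) = 0)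
    (i j : Fin p ⊕ Fin q) :
    mixedForm (fun μ ν => wd (Sum.inr ν) (wd (Sum.inl μ) fun w =>
        logDetPlus G w - logDetMinus G w - logDetPlus H w + logDetMinus H w) z) i j
      = chernLaplacian G (torsionPotential u) z i j
        + mixedForm (Psi H S z (G z) (chernConn G z)) i j := by
  have hB := isSplitOn_boxForm hU hu
  have hd : ∀ {D : Model p q → Coeff p q}, IsSplitOn D U → ∀ i j,
      DifferentiableAt ℝ (fun w => D w i j) z := fun hD i j =>
    differentiableAt_of_contDiffOn hU (hD.smooth i j) hz
  have htor : ∀ i j k, torsion G z i j k = torsion S z i j k + torsion (boxForm u) z i j k := by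
    intro i j k
    rw [← torsion_add (hd hS) (hd hB)]
    have : ∀ k l m, wd m (fun w => G w k l) z = wd m (fun w => (S w + boxForm u w) k l) z :=
      fun k l m => wd_congr m hU hz fun w hw => by rw [hGS w hw]
    simp only [torsion, this]
  rw [chernLaplacian_torsionPotential hU hz hG hu
    (fun a b c => by rw [htor, hp, torsion_boxForm_inl hU hz hu, add_zero])
    (fun a b c => by rw [htor, hm, torsion_boxForm_inr hU hz hu, add_zero])]
  -- From here on the potential is eliminated: each trace of `boxForm u` is the trace of `G` minus
  -- that of `S`.
  have hBeq : ∀ w ∈ U, boxForm u w = G w - S w := fun w hw => by rw [hGS w hw, add_sub_cancel_left]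
  have hBwd : ∀ k l m, ∀ w ∈ U, wd m (fun w => boxForm u w k l) w
      = wd m (fun w => (G w - S w) k l) w :=
    fun k l m w hw => wd_congr m hU hw fun x hx => by rw [hBeq x hx]
  have hBwd2 : ∀ k l m n, wd n (wd m (fun w => boxForm u w k l)) z
      = wd n (wd m (fun w => (G w - S w) k l)) z :=
    fun k l m n => wd_congr n hU hz (hBwd k l m)
  have s1 : ∀ i j, traceHessPlus G (boxForm u) i j z
      = traceHessPlus G G i j z - traceHessPlus G S i j z := fun i j => by
    rw [← traceHessPlus_sub hU hz hG.toIsSplitOn hS]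
    simp only [traceHessPlus, hBwd _ _ _ z hz, hBwd2]
  have s2 : ∀ i j, traceHessMinus G (boxForm u) i j z
      = traceHessMinus G G i j z - traceHessMinus G S i j z := fun i j => by
    rw [← traceHessMinus_sub hU hz hG.toIsSplitOn hS]
    simp only [traceHessMinus, hBwd _ _ _ z hz, hBwd2]
  have s3 : ∀ μ ν, crossPlus G (boxForm u) μ ν z
      = crossPlus G G μ ν z - crossPlus G S μ ν z := fun i j => by
    rw [← crossPlus_sub hU hz hG.toIsSplitOn hS]
    simp only [crossPlus, hBwd _ _ _ z hz]
  have s4 : ∀ μ ν, crossMinus G (boxForm u) μ ν z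
      = crossMinus G G μ ν z - crossMinus G S μ ν z := fun i j => by
    rw [← crossMinus_sub hU hz hG.toIsSplitOn hS]
    simp only [crossMinus, hBwd _ _ _ z hz]
  have main : ∀ μ ν, wd (Sum.inr ν) (wd (Sum.inl μ) fun w =>
        logDetPlus G w - logDetMinus G w - logDetPlus H w + logDetMinus H w) z
      = (traceHessPlus G (boxForm u) (Sum.inl μ) (Sum.inr ν) z
          - traceHessMinus G (boxForm u) (Sum.inr ν) (Sum.inl μ) z
          - crossPlus G (boxForm u) μ ν z + crossMinus G (boxForm u) μ ν z)
        + Psi H S z (G z) (chernConn G z) μ ν := by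
    intro μ ν
    have c1 := logDetPlus_contDiffOn hG
    have c2 := logDetMinus_contDiffOn hG
    have c3 := logDetPlus_contDiffOn hH
    have c4 := logDetMinus_contDiffOn hH
    have d1 : ∀ {v : Model p q → ℂ}, ContDiffOn ℝ ∞ v U → ∀ w ∈ U, DifferentiableAt ℝ v w :=
      fun hv w hw => differentiableAt_of_contDiffOn hU hv hw
    have d2 : ∀ {v : Model p q → ℂ}, ContDiffOn ℝ ∞ v U → ∀ k, DifferentiableAt ℝ (wd k v) z :=
      fun hv k => differentiableAt_of_contDiffOn hU (wd_contDiffOn k hU hv) hz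
    have l1 : ∀ w ∈ U, wd (Sum.inl μ) (fun w =>
        logDetPlus G w - logDetMinus G w - logDetPlus H w + logDetMinus H w) w
        = wd (Sum.inl μ) (logDetPlus G) w - wd (Sum.inl μ) (logDetMinus G) w
          - wd (Sum.inl μ) (logDetPlus H) w + wd (Sum.inl μ) (logDetMinus H) w := by
      intro w hw
      rw [wd_add _ (((d1 c1 w hw).fun_sub (d1 c2 w hw)).fun_sub (d1 c3 w hw)) (d1 c4 w hw),
        wd_sub _ ((d1 c1 w hw).fun_sub (d1 c2 w hw)) (d1 c3 w hw),
        wd_sub _ (d1 c1 w hw) (d1 c2 w hw)]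
    -- Derivatives are exchanged only in the `T₊` determinants, whose Hessian trace enters `Ψ` with
    -- `∂_{μ₊}` outermost.
    rw [wd_congr _ hU hz l1,
      wd_add _ (((d2 c1 _).fun_sub (d2 c2 _)).fun_sub (d2 c3 _)) (d2 c4 _),
      wd_sub _ ((d2 c1 _).fun_sub (d2 c2 _)) (d2 c3 _), wd_sub _ (d2 c1 _) (d2 c2 _),
      wd_comm _ _ hU hz c1, wd_comm _ _ hU hz c3]
    change wd _ (wd _ (logDetPlus G)) z - wd _ (wd _ (logDetMinus G)) z
      - wd _ (wd _ (logDetPlus H)) z + wd _ (wd _ (logDetMinus H)) z = _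
    -- After substitution the only terms that do not cancel formally are the two cross terms of `G`
    -- with itself, which are equal.
    rw [wd_wd_logDetPlus hG hU hz, wd_wd_logDetMinus hG hU hz, wd_wd_logDetPlus hH hU hz,
      wd_wd_logDetMinus hH hU hz, Psi_eq hU hz hH hS hG, s1, s2, s3, s4, crossPlus_self hG hz]
    ring
  rcases i with i | i <;> rcases j with j | j <;> simp only [mixedForm, main]
  · simp
  · ring
  · simp

end Evolution

/-! ### Affine dependence of `Ψ` on the connection, and the Kähler case. -/

section PsiProperties

variable {p q : ℕ} {U : Set (Model p q)} {z : Model p q} {S H : Model p q → Coeff p q}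

/-- A function of the connection coefficients that is the sum of a constant and a linear form. -/
def IsAffine (F : ConnCoeff p q → ℂ) : Prop :=
  ∃ (c : ℂ) (L : ConnCoeff p q →ₗ[ℂ] ℂ), ∀ A, F A = c + L A

theorem IsAffine.const (c : ℂ) : IsAffine (fun _ : ConnCoeff p q => c) :=
  ⟨c, 0, fun _ => by simp⟩

theorem IsAffine.coord (i j k : Fin p ⊕ Fin q) : IsAffine (fun A : ConnCoeff p q => A i j k) :=
  ⟨0, LinearMap.proj k ∘ₗ LinearMap.proj j ∘ₗ LinearMap.proj i, fun _ => by simp⟩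

theorem IsAffine.add {F F' : ConnCoeff p q → ℂ} (h : IsAffine F) (h' : IsAffine F') :
    IsAffine (fun A => F A + F' A) := by
  obtain ⟨c, L, h⟩ := h
  obtain ⟨c', L', h'⟩ := h'
  exact ⟨c + c', L + L', fun A => by simp only [h, h', LinearMap.add_apply]; ring⟩

theorem IsAffine.mul_const {F : ConnCoeff p q → ℂ} (h : IsAffine F) (k : ℂ) :
    IsAffine (fun A => F A * k) := by
  obtain ⟨c, L, h⟩ := h
  exact ⟨c * k, k • L, fun A => by
    simp only [h, LinearMap.smul_apply, smul_eq_mul]; ring⟩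

theorem IsAffine.const_mul {F : ConnCoeff p q → ℂ} (h : IsAffine F) (k : ℂ) :
    IsAffine (fun A => k * F A) := by
  simpa only [mul_comm k] using h.mul_const k

theorem IsAffine.sub {F F' : ConnCoeff p q → ℂ} (h : IsAffine F) (h' : IsAffine F') :
    IsAffine (fun A => F A - F' A) := by
  simpa only [neg_one_mul, ← sub_eq_add_neg] using h.add (h'.const_mul (-1))

theorem IsAffine.sum {ι : Type*} (s : Finset ι) {F : ι → ConnCoeff p q → ℂ}
    (h : ∀ i, IsAffine (F i)) : IsAffine (fun A => ∑ i ∈ s, F i A) := by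
  choose c L h using h
  exact ⟨∑ i ∈ s, c i, ∑ i ∈ s, L i, fun A => by
    simp only [h, Finset.sum_add_distrib, LinearMap.sum_apply]⟩

theorem isAffine_connTorsion (G : Coeff p q) (i j l : Fin p ⊕ Fin q) :
    IsAffine (fun A => connTorsion G A i j l) :=
  .sum _ fun k => ((IsAffine.coord i j k).sub (.coord j i k)).mul_const _

theorem isAffine_covTorsion (S : Model p q → Coeff p q) (z : Model p q)
    (i j k l : Fin p ⊕ Fin q) : IsAffine (fun A => covTorsion A S z i j k l) :=
  ((IsAffine.const _).sub (.sum _ fun m => (IsAffine.coord i j m).mul_const _)).sub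
    (.sum _ fun m => (IsAffine.coord i k m).mul_const _)

/-- `Ψ` is affine in the connection coefficients. -/
theorem Psi_affine (H S : Model p q → Coeff p q) (z : Model p q) (G : Coeff p q)
    (μ : Fin p) (ν : Fin q) : IsAffine (fun A => Psi H S z G A μ ν) := by
  have hcov : ∀ {m n : ℕ} (x : Fin m → Fin n → ℂ) (i j : Fin p ⊕ Fin q)
      (k : Fin m → Fin p ⊕ Fin q) (l : Fin n → Fin p ⊕ Fin q),
      IsAffine (fun A => ∑ α, ∑ β, x α β * covTorsion A S z i j (k α) (l β)) :=
    fun x i j k l => .sum _ fun α => .sum _ fun β => (isAffine_covTorsion S z _ _ _ _).const_mul _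
  have hquad : ∀ {a b c d : ℕ} (x y : Fin a → Fin b → Fin c → Fin d → ℂ)
      (i j l : Fin a → Fin b → Fin c → Fin d → Fin p ⊕ Fin q),
      IsAffine (fun A => ∑ α, ∑ β, ∑ γ, ∑ σ, x α β γ σ *
        connTorsion G A (i α β γ σ) (j α β γ σ) (l α β γ σ) * y α β γ σ) :=
    fun x y i j l => .sum _ fun α => .sum _ fun β => .sum _ fun γ => .sum _ fun σ =>
      ((isAffine_connTorsion G _ _ _).const_mul _).mul_const _
  -- The four terms in `h` form the constant; each of the others has one factor affine in `A`, all
  -- remaining factors being independent of `A`.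
  exact ((((((IsAffine.const _).sub (hcov _ _ _ _ _)).add (hquad _ _ _ _ _)).add
    (hcov _ _ _ _ _)).add (hquad _ _ _ _ _)).add (hquad _ _ _ _ _)).sub (hquad _ _ _ _ _)

/-- `Ψ` vanishes for Kähler backgrounds. -/
theorem Psi_eq_zero (hU : IsOpen U) (hz : z ∈ U)
    (hH : ∀ w ∈ U, ∀ i j k, torsion H w i j k = 0) (hS : ∀ w ∈ U, ∀ i j k, torsion S w i j k = 0)
    (G : Coeff p q) (A : ConnCoeff p q) (μ : Fin p) (ν : Fin q) : Psi H S z G A μ ν = 0 := by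
  have h : ∀ {D : Model p q → Coeff p q} (_ : ∀ w ∈ U, ∀ i j k, torsion D w i j k = 0)
      (A : ConnCoeff p q) (i j k l : Fin p ⊕ Fin q), covTorsion A D z i j k l = 0 := by
    intro D hD A i j k l
    -- The derivative of the torsion vanishes because the torsion is zero on a neighbourhood, not
    -- just at `z`.
    rw [covTorsion, wd_congr i hU hz fun w hw => hD w hw j k l, wd_const]
    simp [hD z hz]
  simp [Psi, h hH, h hS, hH z hz, hS z hz]

end PsiProperties

/-! ### Metrics read in adapted charts. -/

section Charts

variable {p q : ℕ} {M : Type*} [TopologicalSpace M] [ChartedSpace (Model p q) M]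
  {φ : OpenPartialHomeomorph M (Model p q)} {z : Model p q}

theorem mdifferentiable_of_mem_maximalAtlas
    (hφ : φ ∈ IsManifold.maximalAtlas 𝓘(ℝ, Model p q) ∞ M) :
    φ.MDifferentiable 𝓘(ℝ, Model p q) 𝓘(ℝ, Model p q) :=
  ⟨(contMDiffOn_of_mem_maximalAtlas hφ).mdifferentiableOn (by simp),
    (contMDiffOn_symm_of_mem_maximalAtlas hφ).mdifferentiableOn (by simp)⟩

/-- The differential of the inverse of a chart, as a map out of the model space. -/
def chartVec (φ : OpenPartialHomeomorph M (Model p q)) (z : Model p q) :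
    Model p q →L[ℝ] TangentSpace 𝓘(ℝ, Model p q) (φ.symm z) :=
  mfderiv 𝓘(ℝ, Model p q) 𝓘(ℝ, Model p q) φ.symm z

theorem chartVec_chartEnd (hφ : φ ∈ IsManifold.maximalAtlas 𝓘(ℝ, Model p q) ∞ M)
    (hz : z ∈ φ.target) (J : EndField p q M) (v : Model p q) :
    chartVec φ z (chartEnd φ J z v) = J (φ.symm z) (chartVec φ z v) := by
  have h := (mdifferentiable_of_mem_maximalAtlas hφ).symm_comp_deriv (φ.map_target hz)
  rw [φ.right_inv hz] at h
  exact congrArg (fun L => L (J (φ.symm z) (chartVec φ z v))) h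

theorem chartVec_ne_zero (hφ : φ ∈ IsManifold.maximalAtlas 𝓘(ℝ, Model p q) ∞ M)
    (hz : z ∈ φ.target) {v : Model p q} (hv : v ≠ 0) : chartVec φ z v ≠ 0 := by
  intro h0
  have h := (mdifferentiable_of_mem_maximalAtlas hφ).comp_symm_deriv hz
  have h1 := congrArg (fun L => L v) h
  refine hv (h1.symm.trans ?_)
  change mfderiv 𝓘(ℝ, Model p q) 𝓘(ℝ, Model p q) φ (φ.symm z) (chartVec φ z v) = 0
  rw [h0]
  exact map_zero _

variable [IsManifold 𝓘(ℝ, Model p q) ∞ M]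

theorem chartBilin_apply (g : Metric p q M) (u v : Model p q) :
    chartBilin φ g.inner z u v = g.inner (φ.symm z) (chartVec φ z u) (chartVec φ z v) :=
  rfl

theorem chartBilin_symm (g : Metric p q M) (u v : Model p q) :
    chartBilin φ g.inner z u v = chartBilin φ g.inner z v u := by
  rw [chartBilin_apply, chartBilin_apply, g.symm]

theorem chartBilin_pos (hφ : φ ∈ IsManifold.maximalAtlas 𝓘(ℝ, Model p q) ∞ M)
    (hz : z ∈ φ.target) (g : Metric p q M) {v : Model p q} (hv : v ≠ 0) :
    0 < chartBilin φ g.inner z v v := by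
  rw [chartBilin_apply]
  exact g.pos _ _ (chartVec_ne_zero hφ hz hv)

theorem chartBilin_chartEnd (hφ : φ ∈ IsManifold.maximalAtlas 𝓘(ℝ, Model p q) ∞ M)
    (hz : z ∈ φ.target) {g : Metric p q M} {J : EndField p q M} (hJ : IsHermitian g J)
    (u v : Model p q) :
    chartBilin φ g.inner z (chartEnd φ J z u) (chartEnd φ J z v)
      = chartBilin φ g.inner z u v := by
  rw [chartBilin_apply, chartBilin_apply, chartVec_chartEnd hφ hz, chartVec_chartEnd hφ hz, hJ]

theorem chartBilin_comp (hφ : φ ∈ IsManifold.maximalAtlas 𝓘(ℝ, Model p q) ∞ M)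
    (hz : z ∈ φ.target) (g : Metric p q M) (J : EndField p q M) (u v : Model p q) :
    chartBilin φ (fun x => (g.inner x).comp (J x)) z u v
      = chartBilin φ g.inner z (chartEnd φ J z u) v := by
  change g.inner (φ.symm z) (J (φ.symm z) (chartVec φ z u)) (chartVec φ z v)
    = g.inner (φ.symm z) (chartVec φ z (chartEnd φ J z u)) (chartVec φ z v)
  rw [chartVec_chartEnd hφ hz]

/-- The coordinate field is the tangent map of `φ.symm` applied to a constant field. -/
theorem contMDiffOn_chartVec (hφ : φ ∈ IsManifold.maximalAtlas 𝓘(ℝ, Model p q) ∞ M)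
    (v : Model p q) :
    ContMDiffOn 𝓘(ℝ, Model p q) 𝓘(ℝ, Model p q).tangent ∞
      (fun w => (⟨φ.symm w, chartVec φ w v⟩ : TangentBundle 𝓘(ℝ, Model p q) M)) φ.target := by
  have h := (contMDiffOn_symm_of_mem_maximalAtlas hφ).contMDiffOn_tangentMapWithin (m := ∞)
    (by simp) φ.open_target.uniqueMDiffOn
  have hc : ContMDiffOn 𝓘(ℝ, Model p q) 𝓘(ℝ, Model p q).tangent ∞
      (fun w => (⟨w, v⟩ : TangentBundle 𝓘(ℝ, Model p q) (Model p q))) φ.target :=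
    contMDiffOn_vectorSpace_iff_contDiffOn.2 contDiffOn_const
  refine (h.comp hc fun w hw => hw).congr fun w hw => ?_
  simp only [Function.comp_apply, tangentMapWithin]
  rw [mfderivWithin_of_isOpen φ.open_target hw]
  rfl

theorem contDiffOn_chartBilin (hφ : φ ∈ IsManifold.maximalAtlas 𝓘(ℝ, Model p q) ∞ M)
    (g : Metric p q M) (u v : Model p q) :
    ContDiffOn ℝ ∞ (fun w => chartBilin φ g.inner w u v) φ.target := by
  rw [← contMDiffOn_iff_contDiffOn]
  intro w hw
  have h := ContMDiffWithinAt.clm_bundle_apply₂ (b := φ.symm)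
    (E₁ := fun x : M => TangentSpace 𝓘(ℝ, Model p q) x)
    (E₂ := fun x : M => TangentSpace 𝓘(ℝ, Model p q) x) (E₃ := Bundle.Trivial M ℝ)
    (F₁ := Model p q) (F₂ := Model p q) (F₃ := ℝ) (IB := 𝓘(ℝ, Model p q))
    (ψ := fun x => g.inner (φ.symm x)) (v := fun x => chartVec φ x u) (w := fun x => chartVec φ x v)
    (g.contMDiff.contMDiffAt.comp_contMDiffWithinAt w
      (contMDiffOn_symm_of_mem_maximalAtlas hφ w hw))
    (contMDiffOn_chartVec hφ u w hw) (contMDiffOn_chartVec hφ v w hw)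
  exact (Bundle.contMDiffWithinAt_totalSpace.1 h).2

theorem coeff_contDiffOn (hφ : φ ∈ IsManifold.maximalAtlas 𝓘(ℝ, Model p q) ∞ M)
    (g : Metric p q M) (i j : Fin p ⊕ Fin q) :
    ContDiffOn ℝ ∞ (fun w => coeff φ g w i j) φ.target := by
  have h : ∀ u v, ContDiffOn ℝ ∞ (fun w => (chartBilin φ g.inner w u v : ℂ)) φ.target :=
    fun u v => Complex.ofRealCLM.contDiff.comp_contDiffOn (contDiffOn_chartBilin hφ g u v)
  simp only [coeff, Complex.ofReal_add, Complex.ofReal_sub]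
  exact contDiffOn_const.mul (((h _ _).add (h _ _)).add
    (contDiffOn_const.mul ((h _ _).sub (h _ _))))

/-- The differential of the coefficients of a metric. -/
theorem fderiv_coeff (hφ : φ ∈ IsManifold.maximalAtlas 𝓘(ℝ, Model p q) ∞ M) (hz : z ∈ φ.target)
    (g : Metric p q M) (i j : Fin p ⊕ Fin q) (x : Model p q) :
    let β := fun u v => fderiv ℝ (fun w => chartBilin φ g.inner w u v) z x
    fderiv ℝ (fun w => coeff φ g w i j) z x = (1 / 4 : ℂ) *
      ((β (Pi.single i 1) (Pi.single j 1) + β (Pi.single i Complex.I) (Pi.single j Complex.I) : ℝ)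
      + Complex.I * (β (Pi.single i 1) (Pi.single j Complex.I)
        - β (Pi.single i Complex.I) (Pi.single j 1) : ℝ)) := by
  have h : ∀ u v, HasFDerivAt (fun w => chartBilin φ g.inner w u v)
      (fderiv ℝ (fun w => chartBilin φ g.inner w u v) z) z := fun u v =>
    (((contDiffOn_chartBilin hφ g u v).contDiffAt
      (φ.open_target.mem_nhds hz)).differentiableAt (by simp)).hasFDerivAt
  have h1 := Complex.ofRealCLM.hasFDerivAt.comp z
    ((h (Pi.single i 1) (Pi.single j 1)).add (h (Pi.single i Complex.I) (Pi.single j Complex.I)))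
  have h2 := Complex.ofRealCLM.hasFDerivAt.comp z
    ((h (Pi.single i 1) (Pi.single j Complex.I)).sub (h (Pi.single i Complex.I) (Pi.single j 1)))
  have h3 : HasFDerivAt (fun w => coeff φ g w i j) _ z :=
    (h1.add (h2.const_mul Complex.I)).const_mul (1 / 4 : ℂ)
  rw [h3.fderiv]
  simp
  ring

/-- The standard complex structure of the model space. -/
def stdJ (v : Model p q) : Model p q := fun i => Complex.I * v i

theorem stdJ_stdJ (v : Model p q) : stdJ (stdJ v) = -v := by
  funext i
  simp [stdJ, ← mul_assoc]

theorem stdJ_single (i : Fin p ⊕ Fin q) :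
    stdJ (Pi.single i 1 : Model p q) = Pi.single i Complex.I := by
  funext k
  by_cases h : k = i
  · subst h; simp [stdJ]
  · simp [stdJ, h]

theorem eq_sum_single (x : Model p q) :
    x = ∑ i, ((x i).re • (Pi.single i (1 : ℂ) : Model p q)
      + (x i).im • (Pi.single i Complex.I : Model p q)) := by
  funext k
  rw [Finset.sum_apply, Finset.sum_eq_single k]
  · simp
  · intro j _ hj
    simp [hj.symm]
  · simp

/-- The values of an invariant real bilinear form in terms of its Hermitian coefficients. -/
theorem apply_self_eq_sum (b : Model p q →L[ℝ] Model p q →L[ℝ] ℝ)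
    (hb : ∀ u v, b (stdJ u) (stdJ v) = b u v) (x : Model p q) :
    b x x = 2 * (∑ i, ∑ j, x i * ((1 / 4 : ℂ) *
      ((b (Pi.single i 1) (Pi.single j 1) + b (Pi.single i Complex.I) (Pi.single j Complex.I) : ℝ)
      + Complex.I * (b (Pi.single i 1) (Pi.single j Complex.I)
        - b (Pi.single i Complex.I) (Pi.single j 1) : ℝ))) * star (x j)).re := by
  have h1 : ∀ i j, b (Pi.single i Complex.I) (Pi.single j Complex.I)
      = b (Pi.single i 1) (Pi.single j 1) := fun i j => by
    rw [← stdJ_single, ← stdJ_single, hb]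
  have h2 : ∀ i j, b (Pi.single i Complex.I) (Pi.single j 1)
      = -b (Pi.single i 1) (Pi.single j Complex.I) := fun i j => by
    rw [← hb, ← stdJ_single, stdJ_stdJ, stdJ_single, map_neg, neg_apply]
  conv_lhs => rw [eq_sum_single x]
  simp only [map_sum, sum_apply, map_add, map_smul, add_apply, smul_apply, h1, h2, smul_eq_mul,
    Complex.re_sum, Finset.mul_sum]
  symm
  rw [Finset.sum_comm]
  refine Finset.sum_congr rfl fun i _ => ?_
  simp only [← Finset.sum_add_distrib]
  refine Finset.sum_congr rfl fun j _ => ?_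
  simp
  ring

section
open scoped ComplexOrder

theorem coeff_posDef (hφ : φ ∈ IsManifold.maximalAtlas 𝓘(ℝ, Model p q) ∞ M) (hz : z ∈ φ.target)
    (g : Metric p q M)
    (hb : ∀ u v, chartBilin φ g.inner z (stdJ u) (stdJ v) = chartBilin φ g.inner z u v) :
    (coeff φ g z).PosDef := by
  have hH : (coeff φ g z).IsHermitian := by
    ext i j
    simp only [Matrix.conjTranspose_apply, coeff]
    rw [chartBilin_symm g (Pi.single j 1) (Pi.single i 1),
      chartBilin_symm g (Pi.single j Complex.I) (Pi.single i Complex.I),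
      chartBilin_symm g (Pi.single j 1) (Pi.single i Complex.I),
      chartBilin_symm g (Pi.single j Complex.I) (Pi.single i 1)]
    simp
    ring
  refine Matrix.PosDef.of_dotProduct_mulVec_pos hH fun x hx => ?_
  -- The metric coefficients carry the conjugate on the second index, whereas `star x ⬝ᵥ A x`
  -- conjugates the first vector; hence the evaluation at `star x`.
  have h := apply_self_eq_sum _ hb (star x)
  have hpos := chartBilin_pos hφ hz g (star_ne_zero.2 hx)
  have him := hH.im_star_dotProduct_mulVec_self x
  have hsum : star x ⬝ᵥ (coeff φ g z).mulVec x
      = ∑ i, ∑ j, (star x) i * coeff φ g z i j * star ((star x) j) := by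
    simp only [dotProduct, Matrix.mulVec, Finset.mul_sum, mul_assoc, Pi.star_apply, star_star]
  rw [Complex.pos_iff]
  refine ⟨?_, him.symm⟩
  rw [hsum]
  change _ = 2 * (∑ i, ∑ j, (star x) i * coeff φ g z i j * star ((star x) j)).re at h
  linarith

theorem re_im_det_of_posDef {ι : Type*} [Fintype ι] [DecidableEq ι] {A : Matrix ι ι ℂ}
    (hA : A.PosDef) : 0 < A.det.re ∧ A.det.im = 0 := by
  have h := Complex.pos_iff.1 hA.det_pos
  exact ⟨h.1, h.2.symm⟩

/-- The complex structure `J₋` of the model space. -/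
def splitJ (v : Model p q) : Model p q :=
  Sum.elim (fun α => -(Complex.I * v (Sum.inl α))) (fun α => Complex.I * v (Sum.inr α))

theorem splitJ_single_inl (α : Fin p) (c : ℂ) :
    (splitJ (Pi.single (Sum.inl α) c) : Model p q) = -stdJ (Pi.single (Sum.inl α) c) := by
  funext k
  rcases k with k | k <;> simp [splitJ, stdJ, Pi.single_apply]

theorem splitJ_single_inr (α : Fin q) (c : ℂ) :
    (splitJ (Pi.single (Sum.inr α) c) : Model p q) = stdJ (Pi.single (Sum.inr α) c) := by
  funext k
  rcases k with k | k <;> simp [splitJ, stdJ, Pi.single_apply]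

theorem isSplitMetricOn_coeff {Jp Jm : EndField p q M} (hφ : IsAdapted Jp Jm φ) (g : Metric p q M)
    (hgp : IsHermitian g Jp) (hgm : IsHermitian g Jm) :
    IsSplitMetricOn (coeff φ g) φ.target := by
  have hp : ∀ w ∈ φ.target, ∀ u v, chartBilin φ g.inner w (stdJ u) (stdJ v)
      = chartBilin φ g.inner w u v := fun w hw u v => by
    have h := chartBilin_chartEnd hφ.mem_atlas hw hgp u v
    rwa [hφ.plus w hw, hφ.plus w hw] at h
  have hm : ∀ w ∈ φ.target, ∀ u v, chartBilin φ g.inner w (splitJ u) (splitJ v)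
      = chartBilin φ g.inner w u v := fun w hw u v => by
    have h := chartBilin_chartEnd hφ.mem_atlas hw hgm u v
    rwa [hφ.minus w hw, hφ.minus w hw] at h
  have h0 : ∀ w ∈ φ.target, ∀ (α : Fin p) (β : Fin q) (c d : ℂ),
      chartBilin φ g.inner w (Pi.single (Sum.inl α) c) (Pi.single (Sum.inr β) d) = 0 := by
    intro w hw α β c d
    have h := hm w hw (Pi.single (Sum.inl α) c) (Pi.single (Sum.inr β) d)
    -- Invariance under `J₋` and under `J₊` gives opposite signs on `T₊ × T₋`, so the two factors
    -- are orthogonal.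
    rw [splitJ_single_inl, splitJ_single_inr, map_neg, neg_apply, hp w hw] at h
    linarith
  have h0' : ∀ w ∈ φ.target, ∀ (α : Fin p) (β : Fin q) (c d : ℂ),
      chartBilin φ g.inner w (Pi.single (Sum.inr β) d) (Pi.single (Sum.inl α) c) = 0 :=
    fun w hw α β c d => by rw [chartBilin_symm, h0 w hw]
  have hpd := fun w hw => coeff_posDef hφ.mem_atlas hw g (hp w hw)
  -- The diagonal blocks are principal submatrices of a positive definite matrix.
  have h1 := fun w hw => re_im_det_of_posDef ((hpd w hw).submatrix Sum.inl_injective)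
  have h2 := fun w hw => re_im_det_of_posDef ((hpd w hw).submatrix Sum.inr_injective)
  exact
    { smooth := coeff_contDiffOn hφ.mem_atlas g
      inl_inr := fun w hw α β => by simp [coeff, h0 w hw]
      inr_inl := fun w hw α β => by simp [coeff, h0' w hw]
      plus_re := fun w hw => (h1 w hw).1
      plus_im := fun w hw => (h1 w hw).2
      minus_re := fun w hw => (h2 w hw).1
      minus_im := fun w hw => (h2 w hw).2 }

end

end Charts

/-! ### Vanishing of the pure torsion of a generalized Kähler metric. -/

section Closed

variable {p q : ℕ} {M : Type*} [TopologicalSpace M] [ChartedSpace (Model p q) M]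
  [IsManifold 𝓘(ℝ, Model p q) ∞ M] {φ : OpenPartialHomeomorph M (Model p q)} {z : Model p q}

/-- The derivative in the direction `X` of the entry `g(Y, Z)` of a metric. -/
def metricDeriv (φ : OpenPartialHomeomorph M (Model p q)) (g : Metric p q M) (z : Model p q)
    (X Y Z : Model p q) : ℝ :=
  fderiv ℝ (fun w => chartBilin φ g.inner w Y Z) z X

theorem metricDeriv_neg₁ (g : Metric p q M) (X Y Z : Model p q) :
    metricDeriv φ g z (-X) Y Z = -metricDeriv φ g z X Y Z :=
  map_neg _ _

theorem metricDeriv_neg₂ (g : Metric p q M) (X Y Z : Model p q) :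
    metricDeriv φ g z X (-Y) Z = -metricDeriv φ g z X Y Z := by
  simp only [metricDeriv, map_neg, neg_apply, fderiv_fun_neg]

theorem metricDeriv_neg₃ (g : Metric p q M) (X Y Z : Model p q) :
    metricDeriv φ g z X Y (-Z) = -metricDeriv φ g z X Y Z := by
  simp only [metricDeriv, map_neg, neg_apply, fderiv_fun_neg]

section

variable {g : Metric p q M} {J : EndField p q M} {j : Model p q → Model p q}

theorem kahlerForm_apply (hφ : φ ∈ IsManifold.maximalAtlas 𝓘(ℝ, Model p q) ∞ M)
    (hz : z ∈ φ.target) (hg : IsHermitian g J)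
    (hJ : ∀ w ∈ φ.target, ∀ v, chartEnd φ J w v = j v) (hj : ∀ v, j (j v) = -v)
    (u v : Model p q) :
    kahlerForm φ g J z ![u, v] = chartBilin φ g.inner z (j u) v := by
  rw [kahlerForm, toTwoForm_apply, chartBilin_comp hφ hz, hJ z hz]
  rw [chartBilin_comp hφ hz, chartBilin_comp hφ hz, hJ z hz, hJ z hz,
    ← chartBilin_chartEnd hφ hz hg (j u) v, hJ z hz, hJ z hz, hj, map_neg, neg_apply, neg_neg,
    chartBilin_symm]

theorem differentiableAt_kahlerForm (hφ : φ ∈ IsManifold.maximalAtlas 𝓘(ℝ, Model p q) ∞ M)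
    (hz : z ∈ φ.target) (hJ : ∀ w ∈ φ.target, ∀ v, chartEnd φ J w v = j v) :
    DifferentiableAt ℝ (kahlerForm φ g J) z := by
  have hB : ContDiffOn ℝ ∞ (chartBilin φ (fun x => (g.inner x).comp (J x))) φ.target := by
    refine contDiffOn_clm_apply.2 fun u => contDiffOn_clm_apply.2 fun v => ?_
    refine (contDiffOn_chartBilin hφ g (j u) v).congr fun w hw => ?_
    rw [chartBilin_comp hφ hw, hJ w hw]
  have hd : DifferentiableAt ℝ (chartBilin φ (fun x => (g.inner x).comp (J x))) z :=
    (hB.contDiffAt (φ.open_target.mem_nhds hz)).differentiableAt (by simp)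
  unfold kahlerForm toTwoForm
  simp only [← ContinuousAlternatingMap.alternatizeUncurryFinCLM_apply]
  refine DifferentiableAt.fun_const_smul (R := ℝ) (c := (1 / 2 : ℝ)) ?_
  exact ((ContinuousAlternatingMap.alternatizeUncurryFinCLM (n := 1) ℝ (Model p q)
    ℝ).differentiableAt).comp z ((differentiableAt_const _).clm_comp hd)

/-- The complex structure is constant in the chart, so only the metric entries get differentiated.
-/
theorem extDeriv_kahlerForm (hφ : φ ∈ IsManifold.maximalAtlas 𝓘(ℝ, Model p q) ∞ M)
    (hz : z ∈ φ.target) (hg : IsHermitian g J)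
    (hJ : ∀ w ∈ φ.target, ∀ v, chartEnd φ J w v = j v) (hj : ∀ v, j (j v) = -v)
    (X Y Z : Model p q) :
    extDeriv (kahlerForm φ g J) z ![X, Y, Z] = metricDeriv φ g z X (j Y) Z
      - metricDeriv φ g z Y (j X) Z + metricDeriv φ g z Z (j X) Y := by
  have h : ∀ u v x, fderiv ℝ (fun w => kahlerForm φ g J w ![u, v]) z x
      = metricDeriv φ g z x (j u) v := by
    intro u v x
    have : (fun w => kahlerForm φ g J w ![u, v]) =ᶠ[𝓝 z]
        fun w => chartBilin φ g.inner w (j u) v :=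
      Filter.eventually_of_mem (φ.open_target.mem_nhds hz)
        fun w hw => kahlerForm_apply hφ hw hg hJ hj u v
    rw [this.fderiv_eq, metricDeriv]
  have e0 : (0 : Fin 3).removeNth ![X, Y, Z] = ![Y, Z] := by
    ext i : 1; fin_cases i <;> rfl
  have e1 : (1 : Fin 3).removeNth ![X, Y, Z] = ![X, Z] := by
    ext i : 1; fin_cases i <;> rfl
  have e2 : (2 : Fin 3).removeNth ![X, Y, Z] = ![X, Y] := by
    ext i : 1; fin_cases i <;> rfl
  rw [extDeriv_apply (differentiableAt_kahlerForm hφ hz hJ), Fin.sum_univ_three, e0, e1, e2,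
    h, h, h]
  simp
  ring

end

theorem splitJ_splitJ (v : Model p q) : splitJ (splitJ v) = -v := by
  funext i
  rcases i with i | i <;> simp [splitJ, ← mul_assoc]

variable {g : Metric p q M} {Jp Jm : EndField p q M}

theorem metricDeriv_stdJ (hφ : IsAdapted Jp Jm φ) (hz : z ∈ φ.target) (hg : IsHermitian g Jp)
    (X Y Z : Model p q) :
    metricDeriv φ g z X (stdJ Y) (stdJ Z) = metricDeriv φ g z X Y Z := by
  have : (fun w => chartBilin φ g.inner w (stdJ Y) (stdJ Z)) =ᶠ[𝓝 z]
      fun w => chartBilin φ g.inner w Y Z := by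
    refine Filter.eventually_of_mem (φ.open_target.mem_nhds hz) fun w hw => ?_
    have h := chartBilin_chartEnd hφ.mem_atlas hw hg Y Z
    rwa [hφ.plus w hw, hφ.plus w hw] at h
  rw [metricDeriv, this.fderiv_eq, metricDeriv]

/-- The identity `d₊ᶜω₊ = -d₋ᶜω₋` in adapted coordinates. -/
theorem dc_eq_metricDeriv (hφ : IsAdapted Jp Jm φ) (hz : z ∈ φ.target)
    (hgk : IsGeneralizedKahler g Jp Jm) (X Y Z : Model p q) :
    -(metricDeriv φ g z (stdJ X) (stdJ (stdJ Y)) (stdJ Z)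
      - metricDeriv φ g z (stdJ Y) (stdJ (stdJ X)) (stdJ Z)
      + metricDeriv φ g z (stdJ Z) (stdJ (stdJ X)) (stdJ Y))
    = metricDeriv φ g z (splitJ X) (splitJ (splitJ Y)) (splitJ Z)
      - metricDeriv φ g z (splitJ Y) (splitJ (splitJ X)) (splitJ Z)
      + metricDeriv φ g z (splitJ Z) (splitJ (splitJ X)) (splitJ Y) := by
  have h := congrArg (fun θ => θ ![X, Y, Z]) (hgk.dc_eq φ hφ.mem_atlas z hz)
  have e : ∀ (L : Model p q →L[ℝ] Model p q), L ∘ ![X, Y, Z] = ![L X, L Y, L Z] := by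
    intro L
    ext i : 1; fin_cases i <;> rfl
  have hp : ∀ w ∈ φ.target, ∀ v, chartEnd φ Jp w v = stdJ v := hφ.plus
  have hm : ∀ w ∈ φ.target, ∀ v, chartEnd φ Jm w v = splitJ v := hφ.minus
  simp only [dc, ContinuousAlternatingMap.neg_apply,
    ContinuousAlternatingMap.compContinuousLinearMap_apply, neg_neg, e, hp z hz, hm z hz] at h
  rwa [extDeriv_kahlerForm hφ.mem_atlas hz hgk.hermitian_plus hp stdJ_stdJ,
    extDeriv_kahlerForm hφ.mem_atlas hz hgk.hermitian_minus hm splitJ_splitJ] at h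

/-- The restriction of the metric to a subspace on which `J₋ = ± J₊` is Kähler. -/
theorem metricDeriv_closed (hφ : IsAdapted Jp Jm φ) (hz : z ∈ φ.target)
    (hgk : IsGeneralizedKahler g Jp Jm) {X Y Z : Model p q}
    (h : (splitJ X = stdJ X ∧ splitJ Y = stdJ Y ∧ splitJ Z = stdJ Z) ∨
      (splitJ X = -stdJ X ∧ splitJ Y = -stdJ Y ∧ splitJ Z = -stdJ Z)) :
    metricDeriv φ g z (stdJ X) Y (stdJ Z) - metricDeriv φ g z (stdJ Y) X (stdJ Z)
      + metricDeriv φ g z (stdJ Z) X (stdJ Y) = 0 := by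
  have h1 := dc_eq_metricDeriv hφ hz hgk X Y Z
  simp only [stdJ_stdJ, splitJ_splitJ] at h1
  -- A change of sign of `J` hits two slots of each term and cancels, so in both cases the identity
  -- reads `-E = E`.
  rcases h with ⟨hX, hY, hZ⟩ | ⟨hX, hY, hZ⟩ <;> rw [hX, hY, hZ] at h1 <;>
    simp only [metricDeriv_neg₁, metricDeriv_neg₂, metricDeriv_neg₃] at h1 <;> linarith

theorem torsion_coeff_eq_zero (hφ : IsAdapted Jp Jm φ) (hz : z ∈ φ.target)
    (hgk : IsGeneralizedKahler g Jp Jm) {a b c : Fin p ⊕ Fin q}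
    (h : (∀ k : ℂ, (splitJ (Pi.single a k) : Model p q) = stdJ (Pi.single a k) ∧
        (splitJ (Pi.single b k) : Model p q) = stdJ (Pi.single b k) ∧
        (splitJ (Pi.single c k) : Model p q) = stdJ (Pi.single c k)) ∨
      (∀ k : ℂ, (splitJ (Pi.single a k) : Model p q) = -stdJ (Pi.single a k) ∧
        (splitJ (Pi.single b k) : Model p q) = -stdJ (Pi.single b k) ∧
        (splitJ (Pi.single c k) : Model p q) = -stdJ (Pi.single c k))) :
    torsion (coeff φ g) z a b c = 0 := by
  have hI : ∀ i : Fin p ⊕ Fin q, stdJ (Pi.single i Complex.I : Model p q) = -Pi.single i 1 :=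
    fun i => by rw [← stdJ_single, stdJ_stdJ]
  have hcl : ∀ k l m : ℂ, _ := fun k l m => metricDeriv_closed hφ hz hgk
    (X := Pi.single a k) (Y := Pi.single b l) (Z := Pi.single c m)
    (h.imp (fun h => ⟨(h k).1, (h l).2.1, (h m).2.2⟩) (fun h => ⟨(h k).1, (h l).2.1, (h m).2.2⟩))
  have hi : ∀ X (i j : Fin p ⊕ Fin q), metricDeriv φ g z X (Pi.single i Complex.I)
      (Pi.single j Complex.I) = metricDeriv φ g z X (Pi.single i 1) (Pi.single j 1) :=
    fun X i j => by
      have := metricDeriv_stdJ hφ hz hgk.hermitian_plus X (Pi.single i 1) (Pi.single j 1)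
      rwa [stdJ_single, stdJ_single] at this
  have hi' : ∀ X (i j : Fin p ⊕ Fin q), metricDeriv φ g z X (Pi.single i Complex.I)
      (Pi.single j 1) = -metricDeriv φ g z X (Pi.single i 1) (Pi.single j Complex.I) :=
    fun X i j => by
      have := metricDeriv_stdJ hφ hz hgk.hermitian_plus X (Pi.single i 1) (Pi.single j Complex.I)
      rw [stdJ_single, hI, metricDeriv_neg₃] at this
      linarith
  -- The real and imaginary parts of the torsion are linear combinations of the closedness identity
  -- on the real basis vectors, that is, for each argument multiplied by `1` or `√-1`.
  have c1 := hcl 1 1 1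
  have c2 := hcl 1 1 Complex.I
  have c3 := hcl 1 Complex.I 1
  have c4 := hcl Complex.I 1 1
  have c5 := hcl 1 Complex.I Complex.I
  have c6 := hcl Complex.I 1 Complex.I
  have c7 := hcl Complex.I Complex.I 1
  have c8 := hcl Complex.I Complex.I Complex.I
  simp only [hI, stdJ_single, metricDeriv_neg₁, metricDeriv_neg₃, hi, hi'] at c1 c2 c3 c4 c5 c6 c7 c8
  have hf : ∀ (i j : Fin p ⊕ Fin q) (x : Model p q), _ := fun i j x =>
    fderiv_coeff hφ.mem_atlas hz g i j x
  change ∀ (i j : Fin p ⊕ Fin q) (x : Model p q), fderiv ℝ (fun w => coeff φ g w i j) z x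
    = (1 / 4 : ℂ) * ((metricDeriv φ g z x (Pi.single i 1) (Pi.single j 1)
        + metricDeriv φ g z x (Pi.single i Complex.I) (Pi.single j Complex.I) : ℝ)
      + Complex.I * (metricDeriv φ g z x (Pi.single i 1) (Pi.single j Complex.I)
        - metricDeriv φ g z x (Pi.single i Complex.I) (Pi.single j 1) : ℝ)) at hf
  simp only [torsion, wd, hf, hi, hi']
  apply Complex.ext
  · simp
    linarith
  · simp
    linarith

end Closed

/-! ### Exchanging time and space derivatives on `[0, T)`. -/

section TimeDerivative

variable {E : Type*} [NormedAddCommGroup E] [NormedSpace ℝ E] {F : ℝ × E → ℂ} {T t : ℝ} {U : Set E}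
  {z : E}

theorem uniqueDiffOn_Ico_prod (hU : IsOpen U) : UniqueDiffOn ℝ (Ico 0 T ×ˢ U) :=
  (uniqueDiffOn_Ico 0 T).prod hU.uniqueDiffOn

theorem hasFDerivAt_slice (hU : IsOpen U) (ht : t ∈ Ico 0 T) (hz : z ∈ U)
    (hF : DifferentiableWithinAt ℝ F (Ico 0 T ×ˢ U) (t, z)) :
    HasFDerivAt (fun w => F (t, w))
      ((fderivWithin ℝ F (Ico 0 T ×ˢ U) (t, z)).comp (ContinuousLinearMap.inr ℝ ℝ E)) z := by
  have h : HasFDerivAt (fun w : E => (t, w)) (ContinuousLinearMap.inr ℝ ℝ E) z :=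
    hasFDerivAt_prodMk_right t z
  exact (hF.hasFDerivWithinAt.comp z h.hasFDerivWithinAt fun w hw => ⟨ht, hw⟩).hasFDerivAt
    (hU.mem_nhds hz)

theorem hasDerivWithinAt_slice (hz : z ∈ U)
    (hF : DifferentiableWithinAt ℝ F (Ico 0 T ×ˢ U) (t, z)) :
    HasDerivWithinAt (fun s => F (s, z)) (fderivWithin ℝ F (Ico 0 T ×ˢ U) (t, z) (1, 0))
      (Ico 0 T) t := by
  have h : HasFDerivWithinAt (fun s : ℝ => (s, z)) (ContinuousLinearMap.inl ℝ ℝ E) (Ico 0 T) t :=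
    (hasFDerivAt_prodMk_left t z).hasFDerivWithinAt
  have h1 := (hF.hasFDerivWithinAt.comp t h fun s hs => Set.mk_mem_prod hs hz).hasDerivWithinAt
  rwa [ContinuousLinearMap.comp_apply, ContinuousLinearMap.inl_apply] at h1

/-- Joint smoothness of the space derivative allows the exchange of derivatives to be iterated. -/
theorem contDiffOn_fderiv_slice (hU : IsOpen U) (hF : ContDiffOn ℝ ∞ F (Ico 0 T ×ˢ U)) (v : E) :
    ContDiffOn ℝ ∞ (fun y : ℝ × E => fderiv ℝ (fun w => F (y.1, w)) y.2 v) (Ico 0 T ×ˢ U) := by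
  have h := (hF.fderivWithin (m := ∞) (uniqueDiffOn_Ico_prod hU) (by simp)).clm_apply
    (contDiffOn_const (c := ((0 : ℝ), v)))
  refine h.congr fun y hy => ?_
  rw [(hasFDerivAt_slice hU hy.1 hy.2 (hF.differentiableOn (by simp) y hy)).fderiv]
  simp

/-- Time and space derivatives commute up to the initial time. -/
theorem hasDerivWithinAt_fderiv_slice (hU : IsOpen U) (hF : ContDiffOn ℝ ∞ F (Ico 0 T ×ˢ U))
    (ht : t ∈ Ico 0 T) (hz : z ∈ U) {F' : E → ℂ}
    (hF' : ∀ w ∈ U, HasDerivWithinAt (fun s => F (s, w)) (F' w) (Ico 0 T) t) (v : E) :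
    HasDerivWithinAt (fun s => fderiv ℝ (fun w => F (s, w)) z v) (fderiv ℝ F' z v)
      (Ico 0 T) t := by
  set s := Ico 0 T ×ˢ U with hs
  have hud : UniqueDiffOn ℝ s := uniqueDiffOn_Ico_prod hU
  have hd : ∀ y ∈ s, DifferentiableWithinAt ℝ F s y := hF.differentiableOn (by simp)
  have hd2 : DifferentiableOn ℝ (fderivWithin ℝ F s) s :=
    (hF.fderivWithin (m := ∞) hud (by simp)).differentiableOn (by simp)
  have hy : (t, z) ∈ s := ⟨ht, hz⟩
  have hdv : ∀ x : ℝ × E, DifferentiableWithinAt ℝ (fun y => fderivWithin ℝ F s y x) s (t, z) :=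
    fun x => (hd2 _ hy).clm_apply (differentiableWithinAt_const x)
  have hder : ∀ x y : ℝ × E, fderivWithin ℝ (fun y => fderivWithin ℝ F s y x) s (t, z) y
      = fderivWithin ℝ (fderivWithin ℝ F s) s (t, z) y x := by
    intro x y
    rw [fderivWithin_clm_apply (hud _ hy) (hd2 _ hy) (differentiableWithinAt_const x)]
    simp
  -- At `t = 0` the point lies on the boundary; the second derivative within `s` is still symmetric
  -- there, because the point is a limit of interior points.
  have hcl : (t, z) ∈ closure (interior s) := by
    have hT : (0 : ℝ) ≠ T := (lt_of_le_of_lt ht.1 ht.2).ne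
    rw [hs, interior_prod_eq, closure_prod_eq, interior_Ico, closure_Ioo hT, hU.interior_eq]
    exact ⟨Ico_subset_Icc_self ht, subset_closure hz⟩
  have hsymm : IsSymmSndFDerivWithinAt ℝ F s (t, z) :=
    (hF _ hy).isSymmSndFDerivWithinAt
      (by simp only [minSmoothness_of_isRCLikeNormedField]; exact WithTop.coe_le_coe.2 le_top)
      hud hcl hy
  have h1 := hasDerivWithinAt_slice hz (hdv (0, v))
  rw [hder, hsymm.eq, ← hder] at h1
  have h2 := (hasFDerivAt_slice hU ht hz (hdv (1, 0))).fderiv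
  -- Derivatives within `[0, T)` are unique, so the given time derivative is the partial derivative
  -- of `F`.
  have h3 : (fun w => fderivWithin ℝ F s (t, w) (1, 0)) =ᶠ[𝓝 z] F' :=
    Filter.eventually_of_mem (hU.mem_nhds hz) fun w hw =>
      (uniqueDiffOn_Ico 0 T t ht).eq_deriv _ (hasDerivWithinAt_slice hw (hd _ ⟨ht, hw⟩))
        (hF' w hw)
  have h4 : fderivWithin ℝ (fun y => fderivWithin ℝ F s y (1, 0)) s (t, z) (0, v)
      = fderiv ℝ F' z v := by
    rw [← h3.fderiv_eq, h2]
    simp [hs]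
  rw [h4] at h1
  refine h1.congr_of_mem (fun τ hτ => ?_) ht
  rw [(hasFDerivAt_slice hU hτ hz (hd _ ⟨hτ, hz⟩)).fderiv]
  simp [hs]

end TimeDerivative

/-! ### Exchanging time and Wirtinger derivatives. -/

section WirtingerTime

variable {p q : ℕ} {F : ℝ × Model p q → ℂ} {T t : ℝ} {U : Set (Model p q)} {z : Model p q}

theorem contDiffOn_wd_slice (i : Fin p ⊕ Fin q) (hU : IsOpen U)
    (hF : ContDiffOn ℝ ∞ F (Ico 0 T ×ˢ U)) :
    ContDiffOn ℝ ∞ (fun y : ℝ × Model p q => wd i (fun w => F (y.1, w)) y.2) (Ico 0 T ×ˢ U) :=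
  contDiffOn_const.mul ((contDiffOn_fderiv_slice hU hF _).sub
    (contDiffOn_const.mul (contDiffOn_fderiv_slice hU hF _)))

theorem hasDerivWithinAt_wd_slice (i : Fin p ⊕ Fin q) (hU : IsOpen U)
    (hF : ContDiffOn ℝ ∞ F (Ico 0 T ×ˢ U)) (ht : t ∈ Ico 0 T) (hz : z ∈ U)
    {F' : Model p q → ℂ}
    (hF' : ∀ w ∈ U, HasDerivWithinAt (fun s => F (s, w)) (F' w) (Ico 0 T) t) :
    HasDerivWithinAt (fun s => wd i (fun w => F (s, w)) z) (wd i F' z) (Ico 0 T) t :=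
  ((hasDerivWithinAt_fderiv_slice hU hF ht hz hF' _).sub
    ((hasDerivWithinAt_fderiv_slice hU hF ht hz hF' _).const_mul _)).const_mul _

theorem hasDerivWithinAt_wd_wd_slice (i j : Fin p ⊕ Fin q) (hU : IsOpen U)
    (hF : ContDiffOn ℝ ∞ F (Ico 0 T ×ˢ U)) (ht : t ∈ Ico 0 T) (hz : z ∈ U)
    {F' : Model p q → ℂ}
    (hF' : ∀ w ∈ U, HasDerivWithinAt (fun s => F (s, w)) (F' w) (Ico 0 T) t) :
    HasDerivWithinAt (fun s => wd i (wd j (fun w => F (s, w))) z) (wd i (wd j F') z)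
      (Ico 0 T) t :=
  hasDerivWithinAt_wd_slice (F := fun y => wd j (fun w => F (y.1, w)) y.2) i hU
    (contDiffOn_wd_slice j hU hF) ht hz fun _ hw => hasDerivWithinAt_wd_slice j hU hF ht hw hF'

end WirtingerTime

/-! ### The form `P(h)` and its torsion. -/

section Background

variable {p q : ℕ} {U : Set (Model p q)} {z : Model p q} {B C H : Model p q → Coeff p q}

theorem IsSplitOn.sub (hB : IsSplitOn B U) (hC : IsSplitOn C U) :
    IsSplitOn (fun w => B w - C w) U :=
  ⟨fun i j => (hB.smooth i j).sub (hC.smooth i j),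
    fun w hw α β => by simp [hB.inl_inr w hw, hC.inl_inr w hw],
    fun w hw α β => by simp [hB.inr_inl w hw, hC.inr_inl w hw]⟩

theorem IsSplitOn.const_smul (hB : IsSplitOn B U) (c : ℂ) : IsSplitOn (fun w => c • B w) U :=
  ⟨fun i j => contDiffOn_const.mul (hB.smooth i j),
    fun w hw α β => by simp [hB.inl_inr w hw],
    fun w hw α β => by simp [hB.inr_inl w hw]⟩

theorem torsion_sub (hU : IsOpen U) (hz : z ∈ U) (hB : IsSplitOn B U) (hC : IsSplitOn C U)
    (i j k : Fin p ⊕ Fin q) :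
    torsion (fun w => B w - C w) z i j k = torsion B z i j k - torsion C z i j k := by
  simp only [torsion, Matrix.sub_apply, wd_sub _ (differentiableAt_of_contDiffOn hU (hB.smooth _ _) hz)
    (differentiableAt_of_contDiffOn hU (hC.smooth _ _) hz)]
  ring

theorem torsion_const_smul (hU : IsOpen U) (hz : z ∈ U) (hB : IsSplitOn B U) (c : ℂ)
    (i j k : Fin p ⊕ Fin q) :
    torsion (fun w => c • B w) z i j k = c * torsion B z i j k := by
  simp only [torsion, Matrix.smul_apply, smul_eq_mul,
    wd_mul _ (differentiableAt_const c) (differentiableAt_of_contDiffOn hU (hB.smooth _ _) hz), wd_const]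
  ring

/-- The signs in `P(h)` are those of `δ₊δ₊ᶜ - δ₋δ₋ᶜ`, so `P(h)` locally has the potential `log det
h₋ - log det h₊` and inherits the vanishing pure torsion of `boxForm`. -/
theorem formP_eq (H : Model p q → Coeff p q) :
    formP H = fun w => boxForm (logDetMinus H) w - boxForm (logDetPlus H) w := by
  funext w i j
  rcases i with i | i <;> rcases j with j | j <;>
    simp [formP, boxForm, rhoPlus, rhoMinus] <;> ring

theorem isSplitOn_formP (hU : IsOpen U) (hH : IsSplitMetricOn H U) : IsSplitOn (formP H) U := by
  rw [formP_eq]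
  exact (isSplitOn_boxForm hU (logDetMinus_contDiffOn hH)).sub
    (isSplitOn_boxForm hU (logDetPlus_contDiffOn hH))

theorem torsion_formP_inl (hU : IsOpen U) (hz : z ∈ U) (hH : IsSplitMetricOn H U)
    (a b c : Fin p) : torsion (formP H) z (Sum.inl a) (Sum.inl b) (Sum.inl c) = 0 := by
  have h1 := logDetPlus_contDiffOn hH
  have h2 := logDetMinus_contDiffOn hH
  rw [formP_eq, torsion_sub hU hz (isSplitOn_boxForm hU h2) (isSplitOn_boxForm hU h1),
    torsion_boxForm_inl hU hz h1, torsion_boxForm_inl hU hz h2, sub_zero]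

theorem torsion_formP_inr (hU : IsOpen U) (hz : z ∈ U) (hH : IsSplitMetricOn H U)
    (a b c : Fin q) : torsion (formP H) z (Sum.inr a) (Sum.inr b) (Sum.inr c) = 0 := by
  have h1 := logDetPlus_contDiffOn hH
  have h2 := logDetMinus_contDiffOn hH
  rw [formP_eq, torsion_sub hU hz (isSplitOn_boxForm hU h2) (isSplitOn_boxForm hU h1),
    torsion_boxForm_inr hU hz h1, torsion_boxForm_inr hU hz h2, sub_zero]

end Background

/-! ### The flow read in an adapted chart. -/

section Flow

variable {p q : ℕ} {M : Type*} [TopologicalSpace M] [ChartedSpace (Model p q) M]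
  {φ : OpenPartialHomeomorph M (Model p q)} {z : Model p q} {f : ℝ → M → ℝ} {T t : ℝ}

theorem contDiffOn_flow (hφ : φ ∈ IsManifold.maximalAtlas 𝓘(ℝ, Model p q) ∞ M)
    (hf : ContMDiffOn (𝓘(ℝ, ℝ).prod 𝓘(ℝ, Model p q)) 𝓘(ℝ, ℝ) ∞
      (fun y : ℝ × M => f y.1 y.2) (Ico 0 T ×ˢ univ)) :
    ContDiffOn ℝ ∞ (fun y : ℝ × Model p q => chartFun φ (f y.1) y.2) (Ico 0 T ×ˢ φ.target) := by
  have h1 : ContMDiffOn 𝓘(ℝ, ℝ × Model p q) 𝓘(ℝ, ℝ) ∞ (fun y : ℝ × Model p q => y.1)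
      (Ico 0 T ×ˢ φ.target) := contDiff_fst.contMDiff.contMDiffOn
  have h2 : ContMDiffOn 𝓘(ℝ, ℝ × Model p q) 𝓘(ℝ, Model p q) ∞
      (fun y : ℝ × Model p q => φ.symm y.2) (Ico 0 T ×ˢ φ.target) :=
    (contMDiffOn_symm_of_mem_maximalAtlas hφ).comp contDiff_snd.contMDiff.contMDiffOn
      fun y hy => hy.2
  have h3 := hf.comp (h1.prodMk h2) fun y hy => ⟨hy.1, mem_univ _⟩
  exact Complex.ofRealCLM.contDiff.comp_contDiffOn (contMDiffOn_iff_contDiffOn.1 h3)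

theorem contDiffOn_chartFun (hφ : φ ∈ IsManifold.maximalAtlas 𝓘(ℝ, Model p q) ∞ M)
    (hf : ContMDiffOn (𝓘(ℝ, ℝ).prod 𝓘(ℝ, Model p q)) 𝓘(ℝ, ℝ) ∞
      (fun y : ℝ × M => f y.1 y.2) (Ico 0 T ×ˢ univ)) (ht : t ∈ Ico 0 T) :
    ContDiffOn ℝ ∞ (chartFun φ (f t)) φ.target :=
  (contDiffOn_flow hφ hf).comp (contDiff_prodMk_right t).contDiffOn fun _ hw => ⟨ht, hw⟩

variable [IsManifold 𝓘(ℝ, Model p q) ∞ M] {Jp Jm : EndField p q M} {g : ℝ → Metric p q M}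
  {g₀ h : Metric p q M}

theorem isSplitOn_background (hφ : IsAdapted Jp Jm φ) (hgp : IsHermitian g₀ Jp)
    (hgm : IsHermitian g₀ Jm) (hhp : IsHermitian h Jp) (hhm : IsHermitian h Jm) (t : ℝ) :
    IsSplitOn (background φ g₀ h t) φ.target :=
  (isSplitMetricOn_coeff hφ g₀ hgp hgm).toIsSplitOn.sub
    ((isSplitOn_formP φ.open_target (isSplitMetricOn_coeff hφ h hhp hhm)).const_smul t)

/-- The generalized Kähler condition is only needed for `g₀`; the correction `-t P(h)` adds no pure
torsion. -/
theorem torsion_background_inl (hφ : IsAdapted Jp Jm φ) (hz : z ∈ φ.target)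
    (hgk : IsGeneralizedKahler g₀ Jp Jm) (hhp : IsHermitian h Jp) (hhm : IsHermitian h Jm) (t : ℝ)
    (a b c : Fin p) :
    torsion (background φ g₀ h t) z (Sum.inl a) (Sum.inl b) (Sum.inl c) = 0 := by
  have hH := isSplitMetricOn_coeff hφ h hhp hhm
  have hP := isSplitOn_formP φ.open_target hH
  have hG := isSplitMetricOn_coeff hφ g₀ hgk.hermitian_plus hgk.hermitian_minus
  have hJ : ∀ (a : Fin p) (k : ℂ), (splitJ (Pi.single (Sum.inl a) k) : Model p q)
      = -stdJ (Pi.single (Sum.inl a) k) := splitJ_single_inl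
  refine (torsion_sub φ.open_target hz hG.toIsSplitOn (hP.const_smul t) _ _ _).trans ?_
  rw [torsion_const_smul φ.open_target hz hP, torsion_formP_inl φ.open_target hz hH,
    torsion_coeff_eq_zero hφ hz hgk (Or.inr fun k => ⟨hJ a k, hJ b k, hJ c k⟩), mul_zero, sub_zero]

theorem torsion_background_inr (hφ : IsAdapted Jp Jm φ) (hz : z ∈ φ.target)
    (hgk : IsGeneralizedKahler g₀ Jp Jm) (hhp : IsHermitian h Jp) (hhm : IsHermitian h Jm) (t : ℝ)
    (a b c : Fin q) :
    torsion (background φ g₀ h t) z (Sum.inr a) (Sum.inr b) (Sum.inr c) = 0 := by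
  have hH := isSplitMetricOn_coeff hφ h hhp hhm
  have hP := isSplitOn_formP φ.open_target hH
  have hG := isSplitMetricOn_coeff hφ g₀ hgk.hermitian_plus hgk.hermitian_minus
  have hJ : ∀ (a : Fin q) (k : ℂ), (splitJ (Pi.single (Sum.inr a) k) : Model p q)
      = stdJ (Pi.single (Sum.inr a) k) := splitJ_single_inr
  refine (torsion_sub φ.open_target hz hG.toIsSplitOn (hP.const_smul t) _ _ _).trans ?_
  rw [torsion_const_smul φ.open_target hz hP, torsion_formP_inr φ.open_target hz hH,
    torsion_coeff_eq_zero hφ hz hgk (Or.inl fun k => ⟨hJ a k, hJ b k, hJ c k⟩), mul_zero, sub_zero]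

theorem hasDerivWithinAt_chartFun (hφ : IsAdapted Jp Jm φ) (hhp : IsHermitian h Jp)
    (hhm : IsHermitian h Jm) (hflow : IsPotentialFlow Jp Jm h g f T) (ht : t ∈ Ico 0 T)
    (hz : z ∈ φ.target) :
    HasDerivWithinAt (fun s => chartFun φ (f s) z)
      (logDetPlus (coeff φ (g t)) z - logDetMinus (coeff φ (g t)) z
        - logDetPlus (coeff φ h) z + logDetMinus (coeff φ h) z) (Ico 0 T) t := by
  have hH := isSplitMetricOn_coeff hφ h hhp hhm
  have hG := isSplitMetricOn_coeff hφ (g t) (hflow.hermitian_plus t ht) (hflow.hermitian_minus t ht)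
  have h1 := (hflow.evolution t ht φ hφ z hz).ofReal_comp
  -- Positivity of the four block determinants lets the logarithm of the quotient split.
  rw [Real.log_div (mul_pos (hG.plus_re z hz) (hH.minus_re z hz)).ne'
    (mul_pos (hH.plus_re z hz) (hG.minus_re z hz)).ne',
    Real.log_mul (hG.plus_re z hz).ne' (hH.minus_re z hz).ne',
    Real.log_mul (hH.plus_re z hz).ne' (hG.minus_re z hz).ne'] at h1
  convert! h1 using 1
  simp only [logDetPlus, logDetMinus]
  push_cast
  ring

end Flow

end SplitGK

end

open SplitGK in
theorem mainTheorem11 {p q : ℕ} {M : Type*} [TopologicalSpace M] [ChartedSpace (Model p q) M]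
    [IsManifold 𝓘(ℝ, Model p q) ∞ M]
    (Jp Jm : EndField p q M) (g : ℝ → Metric p q M) (h : Metric p q M) (f : ℝ → M → ℝ) (T : ℝ)
    (hgk : IsGeneralizedKahler (g 0) Jp Jm)
    (hcomm : ∀ (x : M) (v : TangentSpace 𝓘(ℝ, Model p q) x), Jp x (Jm x v) = Jm x (Jp x v))
    (hhp : IsHermitian h Jp) (hhm : IsHermitian h Jm)
    (hflow : IsPotentialFlow Jp Jm h g f T)
    (φ : OpenPartialHomeomorph M (Model p q)) (hφ : IsAdapted Jp Jm φ)
    (t : ℝ) (ht : t ∈ Set.Ico 0 T) (z : Model p q) (hz : z ∈ φ.target) :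
    -- the evolution equation
    (∀ i j : Fin p ⊕ Fin q,
      HasDerivWithinAt (fun s => torsionPotential (chartFun φ (f s)) z i j)
        (chernLaplacian (coeff φ (g t)) (torsionPotential (chartFun φ (f t))) z i j
          + mixedForm (Psi (coeff φ h) (background φ (g 0) h t) z (coeff φ (g t) z)
              (chernConn (coeff φ (g t)) z)) i j)
        (Set.Ico 0 T) t) ∧
    -- `Ψ` is at most linear in the connection of the flowing metric
    (∀ (G : Coeff p q) (μ : Fin p) (ν : Fin q),
      ∃ (c : ℂ) (L : ConnCoeff p q →ₗ[ℂ] ℂ), ∀ A : ConnCoeff p q,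
        Psi (coeff φ h) (background φ (g 0) h t) z G A μ ν = c + L A) ∧
    -- `Ψ` vanishes if the backgrounds `h` and `g̃` are Kähler
    ((∀ w ∈ φ.target, ∀ i j k, torsion (coeff φ h) w i j k = 0) →
      (∀ w ∈ φ.target, ∀ i j k, torsion (background φ (g 0) h t) w i j k = 0) →
      ∀ (μ : Fin p) (ν : Fin q),
        Psi (coeff φ h) (background φ (g 0) h t) z (coeff φ (g t) z)
          (chernConn (coeff φ (g t)) z) μ ν = 0) := by
  have hU := φ.open_target
  have hH := isSplitMetricOn_coeff hφ h hhp hhm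
  have hG := isSplitMetricOn_coeff hφ (g t) (hflow.hermitian_plus t ht) (hflow.hermitian_minus t ht)
  have hS := isSplitOn_background hφ hgk.hermitian_plus hgk.hermitian_minus hhp hhm t
  refine ⟨fun i j => ?_, fun G μ ν => Psi_affine _ _ z G μ ν,
    fun hTh hTg μ ν => Psi_eq_zero hU hz hTh hTg _ _ μ ν⟩
  -- The right-hand side becomes the mixed Hessian of the speed of `f`, so that only the exchange of
  -- `∂_t` with two space derivatives remains.
  rw [← wd_wd_log_det_ratio hU hz hH hS hG (contDiffOn_chartFun hφ.mem_atlas hflow.smooth ht)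
    (hflow.metric_eq t ht φ hφ) (torsion_background_inl hφ hz hgk hhp hhm t)
    (torsion_background_inr hφ hz hgk hhp hhm t)]
  have key := fun (μ : Fin p) (ν : Fin q) =>
    hasDerivWithinAt_wd_wd_slice (F := fun y => chartFun φ (f y.1) y.2) (Sum.inr ν) (Sum.inl μ) hU
      (contDiffOn_flow hφ.mem_atlas hflow.smooth) ht hz
      fun w hw => hasDerivWithinAt_chartFun hφ hhp hhm hflow ht hw
  -- Pure entries are identically zero, and the two mixed entries differ by a sign.
  rcases i with i | i <;> rcases j with j | j
  · exact hasDerivWithinAt_const _ _ _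
  · exact key i j
  · exact (key j i).neg
  · exact hasDerivWithinAt_const _ _ _
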